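/- Notation. For maps $g$ from an open subset of $\mathbb{R}^2$ to $\mathbb{R}^3$, subscripts denote partial derivatives, $g_{xy}=(g_x)_y$, $g_{yx}=(g_y)_x$. Such a $g$ is called $C^{1M}$ if it is $C^1$ and $g_{xy}$, $g_{yx}$ exist, are continuous and are equal. For an immersion $f$ with $C^1$ unit normal $\nu=f_x\times f_y/\|f_x\times f_y\|$ put $E=\langle f_x,f_x\rangle$, $F=\langle f_x,f_y\rangle$, $G=\langle f_y,f_y\rangle$, $\ell=-\langle f_x,\nu_x\rangle$, $m=-\langle f_x,\nu_y\rangle$, $n=-\langle f_y,\nu_y\rangle$ and $K=(\ell n-m^2)/(EG-F^2)$. A parametrization $f$ is asymptotic if $\ell=n=0$ everywhere, and Chebyshev if $E=G=1$ everywhere. Theorem. Let $D\subseteq\mathbb{R}^2$ be open and let $f_0:D\to\mathbb{R}^3$ be a $C^2$ regular immersion (its differential has rank $2$ everywhere) with $K=-1$ on $D$. (1) For every $p\in D$ there are $\varepsilon>0$ and a $C^1$ diffeomorphism $T$ from the square $(-\varepsilon,\varepsilon)^2$ onto an open subset of $D$, with $T(0,0)=p$, such that $f_0\circ T$ is asymptotic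 and Chebyshev, with $m>0$. (2) Let $T$ be any $C^1$ diffeomorphism from an open set $U\subseteq\mathbb{R}^2$ onto an open subset of $D$ such that $f=f_0\circ T$ is asymptotic and Chebyshev. Let $\theta\in[0,\pi]$ be the angle between $f_x$ and $f_y$, and let $N=f_x\times f_y/\sin\theta$. Then on $U$: $f$ is $C^{1M}$; $0<\theta<\pi$; $N$ is $C^{1M}$; and $$N_{xy}=N_{yx}=\cos\theta\,N.$$ If $U$ is connected, then $m>0$ on all of $U$, possibly after interchanging the coordinates $x$ and $y$. If $m>0$ on $U$, then also $$f_{xy}=\sin\theta\,N,\qquad f_x=N\times N_x,\qquad f_y=-N\times N_y .$$ -/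

import Mathlib

open Set

noncomputable section

namespace PseudoSph

/-- The parameter plane. -/
abbrev Plane : Type := ℝ × ℝ

/-- Euclidean three-space. -/
abbrev Space : Type := EuclideanSpace ℝ (Fin 3)

/-- The cross product of Euclidean three-space. -/
def cross (a b : Space) : Space :=
  WithLp.toLp 2 (crossProduct (WithLp.ofLp a) (WithLp.ofLp b))

/-- First partial derivative `g_x`. -/
def dx (g : Plane → Space) (p : Plane) : Space :=
  deriv (fun t : ℝ => g (t, p.2)) p.1

/-- First partial derivative `g_y`. -/
def dy (g : Plane → Space) (p : Plane) : Space :=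
  deriv (fun t : ℝ => g (p.1, t)) p.2

/-- `g` is of class `C^{1M}` on the open set `U`: it is `C^1`, and the mixed second partial
derivatives `g_xy = (g_x)_y` and `g_yx = (g_y)_x` exist, are continuous and are equal. -/
structure IsC1M (g : Plane → Space) (U : Set Plane) : Prop where
  contDiffOn : ContDiffOn ℝ 1 g U
  exists_xy : ∀ p ∈ U, DifferentiableAt ℝ (fun t : ℝ => dx g (p.1, t)) p.2
  exists_yx : ∀ p ∈ U, DifferentiableAt ℝ (fun t : ℝ => dy g (t, p.2)) p.1
  continuousOn_xy : ContinuousOn (dy (dx g)) U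
  continuousOn_yx : ContinuousOn (dx (dy g)) U
  xy_eq_yx : ∀ p ∈ U, dy (dx g) p = dx (dy g) p

/-- The differential of `f` has rank two at every point of `U`. -/
def IsRegularOn (f : Plane → Space) (U : Set Plane) : Prop :=
  ∀ p ∈ U, Function.Injective (fderiv ℝ f p)

/-- The unit normal `f_x × f_y / ‖f_x × f_y‖`. -/
def unitNormal (f : Plane → Space) (p : Plane) : Space :=
  ‖cross (dx f p) (dy f p)‖⁻¹ • cross (dx f p) (dy f p)

/-- Coefficient `E = ⟨f_x, f_x⟩` of the first fundamental form. -/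
def coeffE (f : Plane → Space) (p : Plane) : ℝ := inner ℝ (dx f p) (dx f p)

/-- Coefficient `F = ⟨f_x, f_y⟩` of the first fundamental form. -/
def coeffF (f : Plane → Space) (p : Plane) : ℝ := inner ℝ (dx f p) (dy f p)

/-- Coefficient `G = ⟨f_y, f_y⟩` of the first fundamental form. -/
def coeffG (f : Plane → Space) (p : Plane) : ℝ := inner ℝ (dy f p) (dy f p)

/-- Coefficient `ℓ = -⟨f_x, N_x⟩` of the second fundamental form. -/
def coeffL (f : Plane → Space) (p : Plane) : ℝ := -inner ℝ (dx f p) (dx (unitNormal f) p)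

/-- Coefficient `m = -⟨f_x, N_y⟩` of the second fundamental form. -/
def coeffM (f : Plane → Space) (p : Plane) : ℝ := -inner ℝ (dx f p) (dy (unitNormal f) p)

/-- Coefficient `n = -⟨f_y, N_y⟩` of the second fundamental form. -/
def coeffN (f : Plane → Space) (p : Plane) : ℝ := -inner ℝ (dy f p) (dy (unitNormal f) p)

/-- The Gauss curvature `K = (ℓ n - m²) / (E G - F²)`. -/
def gaussCurvature (f : Plane → Space) (p : Plane) : ℝ :=
  (coeffL f p * coeffN f p - coeffM f p ^ 2) / (coeffE f p * coeffG f p - coeffF f p ^ 2)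

/-- The parametrization `f` is asymptotic on `U`: `ℓ = n = 0`. -/
def IsAsymptoticOn (f : Plane → Space) (U : Set Plane) : Prop :=
  ∀ p ∈ U, coeffL f p = 0 ∧ coeffN f p = 0

/-- The parametrization `f` is Chebyshev on `U`: `⟨f_x, f_x⟩ = ⟨f_y, f_y⟩ = 1`. -/
def IsChebyshevOn (f : Plane → Space) (U : Set Plane) : Prop :=
  ∀ p ∈ U, coeffE f p = 1 ∧ coeffG f p = 1

/-- `T` is a change of coordinates, a `C^1` diffeomorphism of the open set `T.source` onto the
open subset `T.target` of `D`, such that `f ∘ T` is an asymptotic Chebyshev parametrization. -/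
structure IsAsymptoticChebyshevChange (f : Plane → Space) (D : Set Plane)
    (T : OpenPartialHomeomorph Plane Plane) : Prop where
  target_subset : T.target ⊆ D
  contDiffOn : ContDiffOn ℝ 1 T T.source
  contDiffOn_symm : ContDiffOn ℝ 1 T.symm T.target
  asymptotic : IsAsymptoticOn (f ∘ T) T.source
  chebyshev : IsChebyshevOn (f ∘ T) T.source

/-- The coordinates `x`, `y` are labelled so that `m > 0`. Interchanging `x` and `y`
changes the sign of `m`. -/
def IsPositivelyLabelledOn (f : Plane → Space) (U : Set Plane) : Prop :=
  ∀ p ∈ U, 0 < coeffM f p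

/-- The angle `θ ∈ [0, π]` between `f_x` and `f_y`. -/
def theta (f : Plane → Space) (p : Plane) : ℝ :=
  InnerProductGeometry.angle (dx f p) (dy f p)

/-- The normal `N = f_x × f_y / sin θ` of a Chebyshev parametrization. -/
def normalAC (f : Plane → Space) (p : Plane) : Space :=
  (Real.sin (theta f p))⁻¹ • cross (dx f p) (dy f p)

end PseudoSph

end

noncomputable section

open Filter Topology

namespace PseudoSph

/-! After a `C^1` change of coordinates the surface is only `C^1`, so second derivatives of `f` and
the usual Codazzi argument are unavailable. The hypotheses are therefore recast in first-order,
coordinate-free terms (`IsPair`): `⟨df, dN⟩` is symmetric and `dN × dN = -df × df`, the latter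
encoding `K = -1`. These conditions survive `C^1` changes of coordinates (`IsPair.comp`).

In a pair the two vector-valued forms `ω± = df ± N × dN` have rank exactly one, and asymptotic
coordinates with `m > 0` are those in which `ω₋` kills the `x`-direction and `ω₊` kills the
`y`-direction, that is, `f_x = N × N_x` and `f_y = -N × N_y` (the Lelieuvre equations).

Existence: the kernels of `ω±` are merely continuous line fields, which need not be integrable by
`C^1` functions in general. Here, for a suitable fixed tangent vector `c` at the base point, the
functions `r = ⟨c, f⟩` and `s = ⟨N, c × n⟩ / ⟨N, n⟩`, with `n` the normal at that point, are `C^1`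
coordinates in which `⟨c, ω±⟩ = dr ± a ds` with `a = ⟨N, n⟩²` of class `C^1`. Such forms have `C^1`
first integrals (`exists_first_integral`), and these are the characteristic coordinates.

Regularity: the Lelieuvre equations force the mixed derivatives of `f` to exist although `f` and `N`
are only `C^1` (`hasDerivAt_dy_of_lelieuvre`). The result is `f_xy = m N`, orthogonal to `f_x` and
`f_y`. Hence `‖f_x‖` is locally independent of `y` and `‖f_y‖` of `x`, so rescaling each coordinate
separately gives Chebyshev coordinates. Differentiating `N_x = ∓N × f_x` and using `f_xy ∥ N` gives
`N_xy = F N`, where `F = cos θ` in the Chebyshev case. -/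

/-! ### The cross product -/

/-- The cross product as a continuous bilinear map. -/
def crossL : Space →L[ℝ] Space →L[ℝ] Space :=
  (LinearMap.mk₂ ℝ cross
    (fun a b c => by simp [cross])
    (fun r a b => by simp [cross])
    (fun a b c => by simp [cross])
    (fun r a b => by simp [cross])).toContinuousBilinearMap

lemma inner_eq_sum (a b : Space) : inner ℝ a b = a 0 * b 0 + a 1 * b 1 + a 2 * b 2 := by
  simp [PiLp.inner_apply, Fin.sum_univ_three, mul_comm]

@[simp] lemma cross_zero_coord (a b : Space) : cross a b 0 = a 1 * b 2 - a 2 * b 1 := rfl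
@[simp] lemma cross_one_coord (a b : Space) : cross a b 1 = a 2 * b 0 - a 0 * b 2 := rfl
@[simp] lemma cross_two_coord (a b : Space) : cross a b 2 = a 0 * b 1 - a 1 * b 0 := rfl

lemma space_ext {a b : Space} (h0 : a 0 = b 0) (h1 : a 1 = b 1) (h2 : a 2 = b 2) : a = b := by
  ext i; fin_cases i <;> assumption

lemma cross_add_left (a b c : Space) : cross (a + b) c = cross a c + cross b c :=
  crossL.map_add₂ a b c

lemma cross_add_right (a b c : Space) : cross a (b + c) = cross a b + cross a c :=
  (crossL a).map_add b c

lemma cross_sub_left (a b c : Space) : cross (a - b) c = cross a c - cross b c :=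
  crossL.map_sub₂ a b c

lemma cross_sub_right (a b c : Space) : cross a (b - c) = cross a b - cross a c :=
  (crossL a).map_sub b c

lemma cross_smul_left (r : ℝ) (a b : Space) : cross (r • a) b = r • cross a b :=
  crossL.map_smul₂ r a b

lemma cross_smul_right (r : ℝ) (a b : Space) : cross a (r • b) = r • cross a b :=
  (crossL a).map_smul r b

lemma cross_neg_left (a b : Space) : cross (-a) b = -cross a b := crossL.map_neg₂ a b

lemma cross_neg_right (a b : Space) : cross a (-b) = -cross a b := (crossL a).map_neg b

lemma cross_zero_left (a : Space) : cross 0 a = 0 := crossL.map_zero₂ a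

lemma cross_zero_right (a : Space) : cross a 0 = 0 := (crossL a).map_zero

@[simp] lemma cross_self (a : Space) : cross a a = 0 := by
  apply space_ext <;> simp <;> ring

lemma cross_comm (a b : Space) : cross a b = -cross b a := by
  apply space_ext <;> simp <;> ring

/-- `a × (b × c) = ⟨a, c⟩ b - ⟨a, b⟩ c`. -/
lemma cross_cross_right (a b c : Space) :
    cross a (cross b c) = (inner ℝ a c : ℝ) • b - (inner ℝ a b : ℝ) • c := by
  apply space_ext <;> simp [inner_eq_sum] <;> ring

/-- `(a × b) × c = ⟨a, c⟩ b - ⟨b, c⟩ a`. -/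
lemma cross_cross_left (a b c : Space) :
    cross (cross a b) c = (inner ℝ a c : ℝ) • b - (inner ℝ b c : ℝ) • a := by
  apply space_ext <;> simp [inner_eq_sum] <;> ring

lemma inner_cross_cross (a b c d : Space) :
    inner ℝ (cross a b) (cross c d)
      = inner ℝ a c * inner ℝ b d - (inner ℝ a d * inner ℝ b c : ℝ) := by
  simp [inner_eq_sum]; ring

@[simp] lemma inner_self_cross (a b : Space) : inner ℝ a (cross a b) = (0 : ℝ) := by
  simp [inner_eq_sum]; ring

@[simp] lemma inner_other_cross (a b : Space) : inner ℝ b (cross a b) = (0 : ℝ) := by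
  simp [inner_eq_sum]; ring

@[simp] lemma inner_cross_self (a b : Space) : inner ℝ (cross a b) a = (0 : ℝ) := by
  simp [inner_eq_sum]; ring

@[simp] lemma inner_cross_other (a b : Space) : inner ℝ (cross a b) b = (0 : ℝ) := by
  simp [inner_eq_sum]; ring

/-- Cyclic invariance of the triple product. -/
lemma inner_cross_rotate (a b c : Space) : inner ℝ a (cross b c) = (inner ℝ b (cross c a) : ℝ) := by
  simp [inner_eq_sum]; ring

lemma inner_cross_left (a b c : Space) : inner ℝ (cross a b) c = (inner ℝ a (cross b c) : ℝ) := by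
  simp [inner_eq_sum]; ring

/-- In the plane orthogonal to the unit vector `n` the rotation `n ×` preserves cross products. -/
lemma cross_rot_rot {n a b : Space} (hn : inner ℝ n n = (1 : ℝ)) (ha : inner ℝ n a = (0 : ℝ))
    (hb : inner ℝ n b = (0 : ℝ)) : cross (cross n a) (cross n b) = cross a b := by
  have h : cross (cross n a) (cross n b) = (inner ℝ n (cross a b) : ℝ) • n := by
    rw [cross_cross_right, inner_cross_self, zero_smul, sub_zero, inner_cross_left]
  have h2 : cross n (cross n (cross a b)) = 0 := by
    rw [cross_cross_right n a b, hb, ha]; simp [cross_zero_right]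
  rw [cross_cross_right, hn, one_smul] at h2
  rw [h]; exact (sub_eq_zero.1 h2)

/-- The rotation `n ×` squares to `-1` on the plane orthogonal to `n`. -/
lemma cross_rot_twice {n a : Space} (hn : inner ℝ n n = (1 : ℝ)) (ha : inner ℝ n a = (0 : ℝ)) :
    cross n (cross n a) = -a := by
  rw [cross_cross_right, hn, ha]; simp

/-- The cross product of two vectors orthogonal to the unit vector `n` is a multiple of `n`. -/
lemma cross_eq_smul {n a b : Space} (hn : inner ℝ n n = (1 : ℝ)) (ha : inner ℝ n a = (0 : ℝ))
    (hb : inner ℝ n b = (0 : ℝ)) : cross a b = (inner ℝ n (cross a b) : ℝ) • n := by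
  have h2 : cross n (cross n (cross a b)) = 0 := by
    rw [cross_cross_right n a b, hb, ha]; simp [cross_zero_right]
  rw [cross_cross_right, hn, one_smul] at h2
  exact (sub_eq_zero.1 h2).symm

/-- A vector orthogonal to a basis of the form `n, a, b` vanishes. -/
lemma eq_zero_of_orthogonal {n a b w : Space} {g : ℝ} (hn : inner ℝ n n = (1 : ℝ))
    (hg : cross a b = g • n) (hg0 : g ≠ 0) (hwn : inner ℝ w n = (0 : ℝ))
    (hwa : inner ℝ w a = (0 : ℝ)) (hwb : inner ℝ w b = (0 : ℝ)) : w = 0 := by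
  have h1 : cross w (cross a b) = 0 := by rw [cross_cross_right, hwa, hwb]; simp
  rw [hg, cross_smul_right, smul_eq_zero_iff_right hg0] at h1
  have h2 : cross n (cross w n) = w := by
    rw [cross_cross_right, hn, real_inner_comm, hwn]; simp
  rw [← h2, h1, cross_zero_right]

lemma cross_eq_zero_imp_dep {a b : Space} (h : cross a b = 0) (ha : a ≠ 0) :
    ∃ r : ℝ, b = r • a := by
  have h1 : cross a (cross a b) = 0 := by rw [h, cross_zero_right]
  rw [cross_cross_right, sub_eq_zero] at h1
  have haa : (inner ℝ a a : ℝ) ≠ 0 := inner_self_ne_zero.2 ha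
  refine ⟨(inner ℝ a b : ℝ) / inner ℝ a a, ?_⟩
  rw [div_eq_inv_mul, mul_smul, h1, smul_smul, inv_mul_cancel₀ haa, one_smul]

lemma norm_cross_sq (a b : Space) :
    ‖cross a b‖ ^ 2 = inner ℝ a a * inner ℝ b b - (inner ℝ a b : ℝ) ^ 2 := by
  rw [← real_inner_self_eq_norm_sq, inner_cross_cross, real_inner_comm a b]; ring

lemma _root_.HasDerivAt.cross {f g : ℝ → Space} {f' g' : Space} {x : ℝ}
    (hf : HasDerivAt f f' x) (hg : HasDerivAt g g' x) :
    HasDerivAt (fun y => PseudoSph.cross (f y) (g y))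
      (PseudoSph.cross (f x) g' + PseudoSph.cross f' (g x)) x := by
  exact crossL.hasDerivAt_of_bilinear (fun _ => hf) (fun _ => hg)

lemma contDiff_cross {n : WithTop ℕ∞} : ContDiff ℝ n fun p : Space × Space => cross p.1 p.2 :=
  crossL.isBoundedBilinearMap.contDiff

lemma continuous_cross : Continuous fun p : Space × Space => cross p.1 p.2 :=
  crossL.isBoundedBilinearMap.continuous

lemma _root_.ContDiffAt.cross {E : Type*} [NormedAddCommGroup E] [NormedSpace ℝ E]
    {f g : E → Space} {x : E} {n : WithTop ℕ∞} (hf : ContDiffAt ℝ n f x) (hg : ContDiffAt ℝ n g x) :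
    ContDiffAt ℝ n (fun y => PseudoSph.cross (f y) (g y)) x :=
  ContDiffAt.comp (f := fun y => (f y, g y)) (g := fun p : Space × Space => PseudoSph.cross p.1 p.2)
    x contDiff_cross.contDiffAt (hf.prodMk hg)

lemma tendsto_cross {ι : Type*} {l : Filter ι} {f g : ι → Space} {a b : Space}
    (hf : Tendsto f l (𝓝 a)) (hg : Tendsto g l (𝓝 b)) :
    Tendsto (fun y => cross (f y) (g y)) l (𝓝 (cross a b)) := by
  have h := (continuous_cross.tendsto (a, b)).comp (hf.prodMk_nhds hg)
  exact h

lemma _root_.ContinuousAt.cross {E : Type*} [TopologicalSpace E]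
    {f g : E → Space} {x : E} (hf : ContinuousAt f x) (hg : ContinuousAt g x) :
    ContinuousAt (fun y => PseudoSph.cross (f y) (g y)) x :=
  tendsto_cross hf hg

/-! ### Partial derivatives -/

lemma hasDerivAt_slice_fst {F : Type*} [NormedAddCommGroup F] [NormedSpace ℝ F]
    {g : Plane → F} {g' : Plane →L[ℝ] F} {p : Plane} (h : HasFDerivAt g g' p) :
    HasDerivAt (fun t : ℝ => g (t, p.2)) (g' (1, 0)) p.1 := by
  have h1 : HasDerivAt (fun t : ℝ => ((t, p.2) : Plane)) (1, 0) p.1 :=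
    (hasDerivAt_id p.1).prodMk (hasDerivAt_const p.1 p.2)
  exact HasFDerivAt.comp_hasDerivAt p.1 (f := fun t : ℝ => ((t, p.2) : Plane)) h h1

lemma hasDerivAt_slice_snd {F : Type*} [NormedAddCommGroup F] [NormedSpace ℝ F]
    {g : Plane → F} {g' : Plane →L[ℝ] F} {p : Plane} (h : HasFDerivAt g g' p) :
    HasDerivAt (fun t : ℝ => g (p.1, t)) (g' (0, 1)) p.2 := by
  have h1 : HasDerivAt (fun t : ℝ => ((p.1, t) : Plane)) (0, 1) p.2 :=
    (hasDerivAt_const p.2 p.1).prodMk (hasDerivAt_id p.2)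
  exact HasFDerivAt.comp_hasDerivAt p.2 (f := fun t : ℝ => ((p.1, t) : Plane)) h h1

lemma dx_eq_fderiv {g : Plane → Space} {p : Plane} (h : DifferentiableAt ℝ g p) :
    dx g p = fderiv ℝ g p (1, 0) := (hasDerivAt_slice_fst h.hasFDerivAt).deriv

lemma dy_eq_fderiv {g : Plane → Space} {p : Plane} (h : DifferentiableAt ℝ g p) :
    dy g p = fderiv ℝ g p (0, 1) := (hasDerivAt_slice_snd h.hasFDerivAt).deriv

lemma fderiv_plane_apply {g : Plane → Space} {p : Plane} (h : DifferentiableAt ℝ g p) (v : Plane) :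
    fderiv ℝ g p v = v.1 • dx g p + v.2 • dy g p := by
  rw [dx_eq_fderiv h, dy_eq_fderiv h, ← map_smul, ← map_smul, ← map_add]; simp

lemma hasDerivAt_dx {g : Plane → Space} {p : Plane} (h : DifferentiableAt ℝ g p) :
    HasDerivAt (fun t : ℝ => g (t, p.2)) (dx g p) p.1 := by
  rw [dx_eq_fderiv h]; exact hasDerivAt_slice_fst h.hasFDerivAt

lemma hasDerivAt_dy {g : Plane → Space} {p : Plane} (h : DifferentiableAt ℝ g p) :
    HasDerivAt (fun t : ℝ => g (p.1, t)) (dy g p) p.2 := by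
  rw [dy_eq_fderiv h]; exact hasDerivAt_slice_snd h.hasFDerivAt

lemma continuousAt_dx {g : Plane → Space} {p : Plane} (h : ContDiffAt ℝ 1 g p) :
    ContinuousAt (dx g) p := by
  have h1 : ContinuousAt (fun q => fderiv ℝ g q (1, 0)) p :=
    (h.continuousAt_fderiv (by simp)).clm_apply continuousAt_const
  refine h1.congr ?_
  filter_upwards [h.eventually (by simp)] with q hq
  exact (dx_eq_fderiv (hq.differentiableAt (by simp))).symm

lemma continuousAt_dy {g : Plane → Space} {p : Plane} (h : ContDiffAt ℝ 1 g p) :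
    ContinuousAt (dy g) p := by
  have h1 : ContinuousAt (fun q => fderiv ℝ g q (0, 1)) p :=
    (h.continuousAt_fderiv (by simp)).clm_apply continuousAt_const
  refine h1.congr ?_
  filter_upwards [h.eventually (by simp)] with q hq
  exact (dy_eq_fderiv (hq.differentiableAt (by simp))).symm

lemma eventually_slice_fst {p : Plane} {P : Plane → Prop} (h : ∀ᶠ q in 𝓝 p, P q) :
    ∀ᶠ t in 𝓝 p.1, P (t, p.2) :=
  (Continuous.prodMk_left p.2).continuousAt (x := p.1) h

lemma eventually_slice_snd {p : Plane} {P : Plane → Prop} (h : ∀ᶠ q in 𝓝 p, P q) :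
    ∀ᶠ t in 𝓝 p.2, P (p.1, t) :=
  (Continuous.prodMk_right p.1).continuousAt (x := p.2) h

lemma dx_congr {g h : Plane → Space} {p : Plane} (e : g =ᶠ[𝓝 p] h) : dx g p = dx h p :=
  Filter.EventuallyEq.deriv_eq (eventually_slice_fst e)

lemma dy_congr {g h : Plane → Space} {p : Plane} (e : g =ᶠ[𝓝 p] h) : dy g p = dy h p :=
  Filter.EventuallyEq.deriv_eq (eventually_slice_snd e)

lemma dx_comp_swap (g : Plane → Space) (p : Plane) : dx (g ∘ Prod.swap) p = dy g p.swap := rfl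

lemma dy_comp_swap (g : Plane → Space) (p : Plane) : dy (g ∘ Prod.swap) p = dx g p.swap := rfl

/-! ### Mixed derivatives of maps satisfying the Lelieuvre equations -/

/-- Difference quotients of a `C^1` map in the second variable converge locally uniformly. -/
lemma tendsto_diffQuot_snd {N : Plane → Space} {p : Plane} (hN : ContDiffAt ℝ 1 N p) :
    Tendsto (fun n : ℝ × ℝ => n.1⁻¹ • (N (n.2, p.2 + n.1) - N (n.2, p.2)))
      (𝓝[≠] 0 ×ˢ 𝓝 p.1) (𝓝 (dy N p)) := by
  -- Strict differentiability gives convergence while the base point `(n.2, p.2)` also moves.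
  have hs := (hN.hasStrictFDerivAt (by simp)).isLittleO
  have ht : Tendsto (fun n : ℝ × ℝ => (((n.2, p.2 + n.1) : Plane), ((n.2, p.2) : Plane)))
      (𝓝[≠] 0 ×ˢ 𝓝 p.1) (𝓝 (p, p)) := by
    have hc : Continuous fun n : ℝ × ℝ => (((n.2, p.2 + n.1) : Plane), ((n.2, p.2) : Plane)) := by
      fun_prop
    have := hc.tendsto ((0 : ℝ), p.1)
    simp only [add_zero, nhds_prod_eq (X := ℝ) (x := (0 : ℝ))] at this
    exact this.mono_left (Filter.prod_mono nhdsWithin_le_nhds le_rfl)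
  have h1 := hs.comp_tendsto ht
  have h2 : (fun n : ℝ × ℝ => (N (n.2, p.2 + n.1) - N (n.2, p.2)) - n.1 • dy N p)
      =o[𝓝[≠] 0 ×ˢ 𝓝 p.1] (fun n : ℝ × ℝ => n.1) := by
    refine (h1.congr_left ?_).trans_le ?_
    · intro n
      simp only [Function.comp_apply, Prod.mk_sub_mk, sub_self, add_sub_cancel_left]
      rw [dy_eq_fderiv (hN.differentiableAt (by simp)), ← map_smul]
      simp
    · intro n
      simp [Prod.norm_def]
  have h3 := h2.tendsto_inv_smul_nhds_zero
  have h4 := h3.add_const (dy N p)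
  rw [zero_add] at h4
  refine h4.congr' ?_
  have hne : ∀ᶠ n : ℝ × ℝ in 𝓝[≠] 0 ×ˢ 𝓝 p.1, n.1 ≠ 0 :=
    (eventually_mem_nhdsWithin (a := (0 : ℝ)) (s := {0}ᶜ)).prod_inl _
  filter_upwards [hne] with n hn
  rw [smul_sub, smul_smul, inv_mul_cancel₀ hn, one_smul, sub_add_cancel]

/-- If `f_x = σ N × N_x` and `f_y = -σ N × N_y`, then `f_yx` exists and is `σ N_y × N_x`. -/
lemma hasDerivAt_dy_of_lelieuvre {f N : Plane → Space} {p : Plane} {σ : ℝ}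
    (hf : ContDiffAt ℝ 1 f p) (hN : ContDiffAt ℝ 1 N p)
    (hx : ∀ᶠ q in 𝓝 p, dx f q = σ • cross (N q) (dx N q))
    (hy : ∀ᶠ q in 𝓝 p, dy f q = -(σ • cross (N q) (dy N q))) :
    HasDerivAt (fun t : ℝ => dy f (t, p.2)) (σ • cross (dy N p) (dx N p)) p.1 := by
  set l : Filter ℝ := 𝓝[≠] 0
  have hfd : ∀ᶠ q in 𝓝 p, DifferentiableAt ℝ f q :=
    (hf.eventually (by simp)).mono fun q hq => hq.differentiableAt (by simp)
  have hNd : ∀ᶠ q in 𝓝 p, DifferentiableAt ℝ N q :=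
    (hN.eventually (by simp)).mono fun q hq => hq.differentiableAt (by simp)
  have ht0 : Tendsto (fun n : ℝ × ℝ => ((n.2, p.2) : Plane)) (l ×ˢ 𝓝 p.1) (𝓝 p) := by
    have hc : Continuous fun n : ℝ × ℝ => ((n.2, p.2) : Plane) := by fun_prop
    have := hc.tendsto ((0 : ℝ), p.1)
    simp only [nhds_prod_eq (X := ℝ) (x := (0 : ℝ))] at this
    exact this.mono_left (Filter.prod_mono nhdsWithin_le_nhds le_rfl)
  have ht1 : Tendsto (fun n : ℝ × ℝ => ((n.2, p.2 + n.1) : Plane)) (l ×ˢ 𝓝 p.1) (𝓝 p) := by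
    have hc : Continuous fun n : ℝ × ℝ => ((n.2, p.2 + n.1) : Plane) := by fun_prop
    have := hc.tendsto ((0 : ℝ), p.1)
    simp only [add_zero, nhds_prod_eq (X := ℝ) (x := (0 : ℝ))] at this
    exact this.mono_left (Filter.prod_mono nhdsWithin_le_nhds le_rfl)
  -- The correction by `σ N × (N⁺ - N)`, with `N⁺` the shift of `N` by `k` in `y`, is chosen so that
  -- `∂ₓF` is a multiple of `(N⁺ - N) × (N⁺_x + N_x)`: no difference of `N_x` is left, so its
  -- quotient by `k` converges. The limit of `F` itself is `f_y - σ N × N_y = 2 f_y`.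
  let F : ℝ → ℝ → Space := fun k x => k⁻¹ • (f (x, p.2 + k) - f (x, p.2)
    - σ • cross (N (x, p.2)) (N (x, p.2 + k) - N (x, p.2)))
  let F' : ℝ → ℝ → Space := fun k x => σ • cross (k⁻¹ • (N (x, p.2 + k) - N (x, p.2)))
    (dx N (x, p.2 + k) + dx N (x, p.2))
  let G' : ℝ → Space := fun x => σ • cross (dy N (x, p.2)) (dx N (x, p.2) + dx N (x, p.2))
  have hF : ∀ᶠ n : ℝ × ℝ in l ×ˢ 𝓝 p.1, HasDerivAt (F n.1) (F' n.1 n.2) n.2 := by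
    filter_upwards [ht0.eventually hfd, ht1.eventually hfd, ht0.eventually hNd,
      ht1.eventually hNd, ht0.eventually hx, ht1.eventually hx] with n a0 a1 b0 b1 c0 c1
    have a1' : HasDerivAt (fun t : ℝ => f (t, p.2 + n.1)) _ n.2 := hasDerivAt_dx a1
    have a0' : HasDerivAt (fun t : ℝ => f (t, p.2)) _ n.2 := hasDerivAt_dx a0
    have b1' : HasDerivAt (fun t : ℝ => N (t, p.2 + n.1)) _ n.2 := hasDerivAt_dx b1
    have b0' : HasDerivAt (fun t : ℝ => N (t, p.2)) _ n.2 := hasDerivAt_dx b0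
    have d := (a1'.sub a0').sub ((b0'.cross (b1'.sub b0')).const_smul σ)
    refine (d.const_smul n.1⁻¹).congr_deriv ?_
    simp only [F', c0, c1, Pi.sub_apply]
    rw [cross_smul_left, smul_comm σ]
    congr 1
    rw [← smul_sub, ← smul_sub]
    congr 1
    simp only [cross_sub_left, cross_sub_right, cross_add_right]
    rw [cross_comm (dx N (n.2, p.2)) (N (n.2, p.2 + n.1)),
      cross_comm (dx N (n.2, p.2)) (N (n.2, p.2))]
    abel
  have hG : ∀ᶠ x in 𝓝 p.1, Tendsto (fun k => F k x) l (𝓝 ((2 : ℝ) • dy f (x, p.2))) := by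
    filter_upwards [eventually_slice_fst hfd, eventually_slice_fst hNd,
      eventually_slice_fst hy] with x a b c
    have h1 : HasDerivAt (fun t : ℝ => f (x, t)) (dy f (x, p.2)) p.2 := hasDerivAt_dy a
    have h2 : HasDerivAt (fun t : ℝ => N (x, t)) (dy N (x, p.2)) p.2 := hasDerivAt_dy b
    have h1 := h1.tendsto_slope_zero
    have h2 := (tendsto_cross (tendsto_const_nhds (x := N (x, p.2))) h2.tendsto_slope_zero).const_smul σ
    have h3 := h1.sub h2
    rw [show (dy f (x, p.2) - σ • cross (N (x, p.2)) (dy N (x, p.2)))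
      = (2 : ℝ) • dy f (x, p.2) by rw [two_smul, sub_eq_add_neg, ← c]] at h3
    refine h3.congr fun k => ?_
    simp only [F]
    rw [cross_smul_right, smul_comm σ]
    simp only [smul_sub]
  have hlim : Tendsto (fun n : ℝ × ℝ => F' n.1 n.2) (l ×ˢ 𝓝 p.1) (𝓝 (G' p.1)) :=
    (tendsto_cross (tendsto_diffQuot_snd hN)
      (((continuousAt_dx hN).tendsto.comp ht1).add
        ((continuousAt_dx hN).tendsto.comp ht0))).const_smul σ
  have hlim0 : Tendsto (fun n : ℝ × ℝ => G' n.2) (l ×ˢ 𝓝 p.1) (𝓝 (G' p.1)) :=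
    (tendsto_cross ((continuousAt_dy hN).tendsto.comp ht0)
      (((continuousAt_dx hN).tendsto.comp ht0).add
        ((continuousAt_dx hN).tendsto.comp ht0))).const_smul σ
  -- Uniformity near `p.1` holds because `F'` and `G'` have the same joint limit as `k → 0` and `x →
  -- p.1`.
  have hunif : TendstoUniformlyOnFilter F' G' l (𝓝 p.1) := by
    rw [Metric.tendstoUniformlyOnFilter_iff]
    intro ε hε
    have := hlim0.dist hlim
    rw [dist_self] at this
    exact this.eventually (gt_mem_nhds hε)
  have key := (hasDerivAt_of_tendstoUniformlyOnFilter hunif hF hG).const_smul (2⁻¹ : ℝ)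
  refine (key.congr_deriv ?_).congr_of_eventuallyEq (Eventually.of_forall fun t => ?_)
  · simp only [G', ← two_smul ℝ, cross_smul_right]
    rw [smul_comm σ, smul_smul]
    norm_num
  · simp [smul_smul]

/-- If `f_x = σ N × N_x` and `f_y = -σ N × N_y`, then `f_xy` exists and is `σ N_y × N_x`. -/
lemma hasDerivAt_dx_of_lelieuvre {f N : Plane → Space} {p : Plane} {σ : ℝ}
    (hf : ContDiffAt ℝ 1 f p) (hN : ContDiffAt ℝ 1 N p)
    (hx : ∀ᶠ q in 𝓝 p, dx f q = σ • cross (N q) (dx N q))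
    (hy : ∀ᶠ q in 𝓝 p, dy f q = -(σ • cross (N q) (dy N q))) :
    HasDerivAt (fun t : ℝ => dx f (p.1, t)) (σ • cross (dy N p) (dx N p)) p.2 := by
  have hsw : Tendsto Prod.swap (𝓝 p.swap) (𝓝 p) := by
    have := continuous_swap.tendsto p.swap
    rwa [Prod.swap_swap] at this
  have hsd : ContDiffAt ℝ 1 (Prod.swap : Plane → Plane) p.swap :=
    (contDiff_snd.prodMk contDiff_fst).contDiffAt
  -- Interchanging the coordinates swaps the two equations and replaces `σ` by `-σ`.
  have h := hasDerivAt_dy_of_lelieuvre (f := f ∘ Prod.swap) (N := N ∘ Prod.swap) (p := p.swap)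
    (σ := -σ)
    (ContDiffAt.comp _ (by rwa [Prod.swap_swap]) hsd)
    (ContDiffAt.comp _ (by rwa [Prod.swap_swap]) hsd)
    ((hsw.eventually hy).mono fun q hq => by
      simpa only [dx_comp_swap, Function.comp_apply, neg_smul] using hq)
    ((hsw.eventually hx).mono fun q hq => by
      simpa only [dy_comp_swap, Function.comp_apply, neg_smul, neg_neg] using hq)
  simp only [dx_comp_swap, dy_comp_swap, Prod.swap_swap] at h
  rw [cross_comm, smul_neg, neg_smul, neg_neg] at h
  exact h

/-! ### Pseudospherical pairs -/

/-- A `C^1` immersion `f` with `C^1` unit normal field `N`, symmetric second fundamental form and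
Gauss curvature `-1`, expressed without reference to coordinates. -/
structure IsPair (f N : Plane → Space) (U : Set Plane) : Prop where
  contDiffAt_fst : ∀ p ∈ U, ContDiffAt ℝ 1 f p
  contDiffAt_snd : ∀ p ∈ U, ContDiffAt ℝ 1 N p
  inner_self : ∀ p ∈ U, inner ℝ (N p) (N p) = (1 : ℝ)
  injective : ∀ p ∈ U, Function.Injective (fderiv ℝ f p)
  orth : ∀ p ∈ U, ∀ v, inner ℝ (N p) (fderiv ℝ f p v) = (0 : ℝ)
  symm : ∀ p ∈ U, ∀ v w, inner ℝ (fderiv ℝ f p v) (fderiv ℝ N p w)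
    = (inner ℝ (fderiv ℝ f p w) (fderiv ℝ N p v) : ℝ)
  cross_eq : ∀ p ∈ U, ∀ v w, cross (fderiv ℝ N p v) (fderiv ℝ N p w)
    = -cross (fderiv ℝ f p v) (fderiv ℝ f p w)

lemma cross_dx_dy_ne_zero {f : Plane → Space} {p : Plane} (hf : DifferentiableAt ℝ f p)
    (hi : Function.Injective (fderiv ℝ f p)) : cross (dx f p) (dy f p) ≠ 0 := by
  intro h
  have h0 : dx f p ≠ 0 := by
    rw [dx_eq_fderiv hf]
    intro h1
    have := hi (h1.trans (map_zero _).symm)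
    simp at this
  obtain ⟨r, hr⟩ := cross_eq_zero_imp_dep h h0
  have h2 : fderiv ℝ f p (-r, 1) = 0 := by
    rw [fderiv_plane_apply hf, hr]; simp
  have := hi (h2.trans (map_zero _).symm)
  simp at this

lemma inner_fderiv_eq_zero {N : Plane → Space} {p : Plane} (hN : DifferentiableAt ℝ N p)
    (h : ∀ᶠ q in 𝓝 p, inner ℝ (N q) (N q) = (1 : ℝ)) (v : Plane) :
    inner ℝ (N p) (fderiv ℝ N p v) = (0 : ℝ) := by
  have h1 := hN.hasFDerivAt.inner ℝ hN.hasFDerivAt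
  have h2 : HasFDerivAt (fun q => (inner ℝ (N q) (N q) : ℝ)) (0 : Plane →L[ℝ] ℝ) p :=
    (hasFDerivAt_const (1 : ℝ) p).congr_of_eventuallyEq h
  have h3 := congrArg (fun L : Plane →L[ℝ] ℝ => L v) (h1.unique h2)
  simp [real_inner_comm (N p)] at h3
  linarith [real_inner_comm (N p) (fderiv ℝ N p v)]

namespace IsPair

variable {f N : Plane → Space} {U : Set Plane}

lemma diff_fst (h : IsPair f N U) {p : Plane} (hp : p ∈ U) : DifferentiableAt ℝ f p :=
  (h.contDiffAt_fst p hp).differentiableAt (by simp)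

lemma diff_snd (h : IsPair f N U) {p : Plane} (hp : p ∈ U) : DifferentiableAt ℝ N p :=
  (h.contDiffAt_snd p hp).differentiableAt (by simp)

lemma orth_snd (h : IsPair f N U) (hU : IsOpen U) {p : Plane} (hp : p ∈ U) (v : Plane) :
    inner ℝ (N p) (fderiv ℝ N p v) = (0 : ℝ) :=
  inner_fderiv_eq_zero (h.diff_snd hp) (by filter_upwards [hU.mem_nhds hp] with q hq using h.inner_self q hq) v

end IsPair

/-! ### `C^1` changes of coordinates -/

/-- A local homeomorphism that is `C^1` in both directions. -/
structure IsC1Diffeo (T : OpenPartialHomeomorph Plane Plane) : Prop where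
  contDiffOn : ContDiffOn ℝ 1 T T.source
  contDiffOn_symm : ContDiffOn ℝ 1 T.symm T.target

namespace IsC1Diffeo

variable {T S : OpenPartialHomeomorph Plane Plane}

lemma contDiffAt (h : IsC1Diffeo T) {q : Plane} (hq : q ∈ T.source) : ContDiffAt ℝ 1 T q :=
  h.contDiffOn.contDiffAt (T.open_source.mem_nhds hq)

lemma contDiffAt_symm (h : IsC1Diffeo T) {q : Plane} (hq : q ∈ T.target) :
    ContDiffAt ℝ 1 T.symm q :=
  h.contDiffOn_symm.contDiffAt (T.open_target.mem_nhds hq)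

lemma symm (h : IsC1Diffeo T) : IsC1Diffeo T.symm where
  contDiffOn := h.contDiffOn_symm
  contDiffOn_symm := by simpa using h.contDiffOn

lemma trans (h : IsC1Diffeo T) (k : IsC1Diffeo S) : IsC1Diffeo (T.trans S) where
  contDiffOn := by
    rw [OpenPartialHomeomorph.coe_trans, OpenPartialHomeomorph.trans_source]
    exact k.contDiffOn.comp (h.contDiffOn.mono inter_subset_left) fun x hx => hx.2
  contDiffOn_symm := by
    rw [OpenPartialHomeomorph.coe_trans_symm, OpenPartialHomeomorph.trans_target]
    exact h.contDiffOn_symm.comp (k.contDiffOn_symm.mono inter_subset_left) fun x hx => hx.2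

lemma restrOpen (h : IsC1Diffeo T) {s : Set Plane} (hs : IsOpen s) :
    IsC1Diffeo (T.restrOpen s hs) where
  contDiffOn := h.contDiffOn.mono (by simp)
  contDiffOn_symm := h.contDiffOn_symm.mono
    (by rw [OpenPartialHomeomorph.restrOpen_toPartialEquiv]; exact fun x hx => hx.1)

lemma injective_fderiv (h : IsC1Diffeo T) {q : Plane} (hq : q ∈ T.source) :
    Function.Injective (fderiv ℝ T q) := by
  have h1 := ((h.contDiffAt hq).differentiableAt (by simp)).hasFDerivAt
  have h2 := ((h.contDiffAt_symm (T.map_source hq)).differentiableAt (by simp)).hasFDerivAt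
  have h3 := h2.comp q h1
  have h4 : HasFDerivAt (T.symm ∘ T) (ContinuousLinearMap.id ℝ Plane) q :=
    (hasFDerivAt_id q).congr_of_eventuallyEq (T.eventually_left_inverse hq)
  have h5 := h3.unique h4
  intro v w hvw
  have := congrArg (fderiv ℝ T.symm (T q)) hvw
  have e := fun u => congrArg (fun L : Plane →L[ℝ] Plane => L u) h5
  simp only [ContinuousLinearMap.comp_apply, ContinuousLinearMap.id_apply] at e
  rwa [e, e] at this

end IsC1Diffeo

/-- The conditions are pointwise identities in the differentials, so the chain rule carries them
over; no second derivative of `T` enters. -/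
lemma IsPair.comp {f N : Plane → Space} {U : Set Plane} (h : IsPair f N U)
    {T : OpenPartialHomeomorph Plane Plane} (hT : IsC1Diffeo T) (hTU : T.target ⊆ U) :
    IsPair (f ∘ T) (N ∘ T) T.source := by
  have hm : ∀ q ∈ T.source, T q ∈ U := fun q hq => hTU (T.map_source hq)
  have ef : ∀ q ∈ T.source, ∀ v,
      fderiv ℝ (f ∘ T) q v = fderiv ℝ f (T q) (fderiv ℝ T q v) := fun q hq v => by
    rw [fderiv_comp q (h.diff_fst (hm q hq)) ((hT.contDiffAt hq).differentiableAt (by simp))]; rfl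
  have eN : ∀ q ∈ T.source, ∀ v,
      fderiv ℝ (N ∘ T) q v = fderiv ℝ N (T q) (fderiv ℝ T q v) := fun q hq v => by
    rw [fderiv_comp q (h.diff_snd (hm q hq)) ((hT.contDiffAt hq).differentiableAt (by simp))]; rfl
  exact {
    contDiffAt_fst := fun q hq => (h.contDiffAt_fst _ (hm q hq)).comp q (hT.contDiffAt hq)
    contDiffAt_snd := fun q hq => (h.contDiffAt_snd _ (hm q hq)).comp q (hT.contDiffAt hq)
    inner_self := fun q hq => h.inner_self _ (hm q hq)
    injective := fun q hq v w hvw => by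
      rw [ef q hq, ef q hq] at hvw
      exact hT.injective_fderiv hq (h.injective _ (hm q hq) hvw)
    orth := fun q hq v => by rw [ef q hq]; exact h.orth _ (hm q hq) _
    symm := fun q hq v w => by
      rw [ef q hq, ef q hq, eN q hq, eN q hq]; exact h.symm _ (hm q hq) _ _
    cross_eq := fun q hq v w => by
      rw [ef q hq, ef q hq, eN q hq, eN q hq]; exact h.cross_eq _ (hm q hq) _ _ }

/-- Locally the unit normal field `f_x × f_y / ‖f_x × f_y‖` agrees with `N` up to a sign. -/
lemma IsPair.unitNormal_eventuallyEq {f N : Plane → Space} {U : Set Plane} (h : IsPair f N U)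
    (hU : IsOpen U) {p : Plane} (hp : p ∈ U) :
    ∃ ε : ℝ, ε * ε = 1 ∧ unitNormal f =ᶠ[𝓝 p] fun q => ε • N q := by
  set g : Plane → ℝ := fun q => inner ℝ (N q) (cross (dx f q) (dy f q)) with hg
  have hgN : ∀ q ∈ U, cross (dx f q) (dy f q) = g q • N q := fun q hq => by
    refine cross_eq_smul (h.inner_self q hq) ?_ ?_
    · rw [dx_eq_fderiv (h.diff_fst hq)]; exact h.orth q hq _
    · rw [dy_eq_fderiv (h.diff_fst hq)]; exact h.orth q hq _
  have hN1 : ∀ q ∈ U, ‖N q‖ = 1 := fun q hq => by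
    have := h.inner_self q hq
    rw [real_inner_self_eq_norm_sq] at this
    nlinarith [norm_nonneg (N q)]
  have hun : ∀ q ∈ U, unitNormal f q = (|g q|⁻¹ * g q) • N q := fun q hq => by
    rw [unitNormal, hgN q hq, norm_smul, hN1 q hq, mul_one, smul_smul, Real.norm_eq_abs]
  have hg0 : g p ≠ 0 := fun h0 => by
    have := cross_dx_dy_ne_zero (h.diff_fst hp) (h.injective p hp)
    rw [hgN p hp, h0, zero_smul] at this
    exact this rfl
  have hgc : ContinuousAt g p :=
    (h.contDiffAt_snd p hp).continuousAt.inner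
      ((continuousAt_dx (h.contDiffAt_fst p hp)).cross (continuousAt_dy (h.contDiffAt_fst p hp)))
  rcases lt_or_gt_of_ne hg0 with h0 | h0
  · refine ⟨-1, by norm_num, ?_⟩
    filter_upwards [hgc.eventually (gt_mem_nhds h0), hU.mem_nhds hp] with q hq hqU
    rw [hun q hqU, abs_of_neg hq, inv_neg, neg_mul, inv_mul_cancel₀ (ne_of_lt hq)]
  · refine ⟨1, by norm_num, ?_⟩
    filter_upwards [hgc.eventually (lt_mem_nhds h0), hU.mem_nhds hp] with q hq hqU
    rw [hun q hqU, abs_of_pos hq, inv_mul_cancel₀ (ne_of_gt hq)]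

/-- A change of coordinates may reverse orientation, so the transported normal can differ from the
unit normal of the new parametrization. The sign is locally constant, and every condition is
homogeneous in `N` or quadratic in it. -/
lemma IsPair.unitNormal {f N : Plane → Space} {U : Set Plane} (h : IsPair f N U)
    (hU : IsOpen U) : IsPair f (unitNormal f) U := by
  have key : ∀ p ∈ U, ∃ ε : ℝ, ε * ε = 1 ∧ PseudoSph.unitNormal f =ᶠ[𝓝 p] (fun q => ε • N q) ∧
      PseudoSph.unitNormal f p = ε • N p ∧
      ∀ v, fderiv ℝ (PseudoSph.unitNormal f) p v = ε • fderiv ℝ N p v := fun p hp => by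
    obtain ⟨ε, h1, h2⟩ := h.unitNormal_eventuallyEq hU hp
    refine ⟨ε, h1, h2, h2.self_of_nhds, fun v => ?_⟩
    rw [h2.fderiv_eq, fderiv_fun_const_smul (h.diff_snd hp)]
    rfl
  refine ⟨h.contDiffAt_fst, fun p hp => ?_, fun p hp => ?_, h.injective, fun p hp v => ?_,
    fun p hp v w => ?_, fun p hp v w => ?_⟩ <;> obtain ⟨ε, h1, h2, h3, h4⟩ := key p hp
  · exact ((h.contDiffAt_snd p hp).const_smul ε).congr_of_eventuallyEq h2
  · rw [h3, inner_smul_left, inner_smul_right, h.inner_self p hp]; simpa using h1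
  · rw [h3, inner_smul_left, h.orth p hp, mul_zero]
  · rw [h4, h4, inner_smul_right, inner_smul_right, h.symm p hp]
  · rw [h4, h4, cross_smul_left, cross_smul_right, smul_smul, h1, one_smul, h.cross_eq p hp]

lemma inner_unitNormal_self {f : Plane → Space} {p : Plane}
    (h : cross (dx f p) (dy f p) ≠ 0) : inner ℝ (unitNormal f p) (unitNormal f p) = (1 : ℝ) := by
  rw [real_inner_self_eq_norm_sq, unitNormal, norm_smul, norm_inv, norm_norm,
    inv_mul_cancel₀ (norm_ne_zero_iff.2 h), one_pow]

lemma cross_eq_norm_smul {f : Plane → Space} {p : Plane}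
    (h : cross (dx f p) (dy f p) ≠ 0) :
    cross (dx f p) (dy f p) = ‖cross (dx f p) (dy f p)‖ • unitNormal f p := by
  rw [unitNormal, smul_smul, mul_inv_cancel₀ (norm_ne_zero_iff.2 h), one_smul]

lemma inner_unitNormal_fderiv {f : Plane → Space} {p : Plane} (hf : DifferentiableAt ℝ f p)
    (v : Plane) : inner ℝ (unitNormal f p) (fderiv ℝ f p v) = (0 : ℝ) := by
  rw [fderiv_plane_apply hf, unitNormal, inner_smul_left, inner_add_right, inner_smul_right,
    inner_smul_right]
  simp

/-- A `C^2` immersion of Gauss curvature `-1` and its unit normal form a pseudospherical pair. -/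
lemma isPair_of_gaussCurvature {f : Plane → Space} {D : Set Plane} (hD : IsOpen D)
    (hf : ContDiffOn ℝ 2 f D) (hreg : IsRegularOn f D)
    (hK : ∀ p ∈ D, gaussCurvature f p = -1) : IsPair f (unitNormal f) D := by
  have hf2 : ∀ p ∈ D, ContDiffAt ℝ 2 f p := fun p hp => hf.contDiffAt (hD.mem_nhds hp)
  have hf1 : ∀ p ∈ D, ContDiffAt ℝ 1 f p := fun p hp => (hf2 p hp).of_le (by norm_num)
  have hd : ∀ p ∈ D, DifferentiableAt ℝ f p := fun p hp => (hf1 p hp).differentiableAt (by simp)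
  have hdf : ∀ p ∈ D, ContDiffAt ℝ 1 (fderiv ℝ f) p := fun p hp =>
    (hf2 p hp).fderiv_right (by norm_num)
  have hdx : ∀ p ∈ D, ContDiffAt ℝ 1 (dx f) p := fun p hp => by
    refine ((hdf p hp).clm_apply contDiffAt_const).congr_of_eventuallyEq
      (f := fun q => fderiv ℝ f q (1, 0)) ?_
    filter_upwards [hD.mem_nhds hp] with q hq using dx_eq_fderiv (hd q hq)
  have hdy : ∀ p ∈ D, ContDiffAt ℝ 1 (dy f) p := fun p hp => by
    refine ((hdf p hp).clm_apply contDiffAt_const).congr_of_eventuallyEq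
      (f := fun q => fderiv ℝ f q (0, 1)) ?_
    filter_upwards [hD.mem_nhds hp] with q hq using dy_eq_fderiv (hd q hq)
  have hc0 : ∀ p ∈ D, cross (dx f p) (dy f p) ≠ 0 := fun p hp =>
    cross_dx_dy_ne_zero (hd p hp) (hreg p hp)
  have hN : ∀ p ∈ D, ContDiffAt ℝ 1 (unitNormal f) p := fun p hp => by
    have hc : ContDiffAt ℝ 1 (fun q => cross (dx f q) (dy f q)) p := (hdx p hp).cross (hdy p hp)
    exact ((hc.norm ℝ (hc0 p hp)).inv (norm_ne_zero_iff.2 (hc0 p hp))).smul hc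
  have hNd : ∀ p ∈ D, DifferentiableAt ℝ (unitNormal f) p := fun p hp =>
    (hN p hp).differentiableAt (by simp)
  have hsymm : ∀ p ∈ D, ∀ v w, inner ℝ (fderiv ℝ f p v) (fderiv ℝ (unitNormal f) p w)
      = (inner ℝ (fderiv ℝ f p w) (fderiv ℝ (unitNormal f) p v) : ℝ) := fun p hp => by
    -- Differentiating `⟨ν, df v⟩ = 0` along `w` reduces the claim to the symmetry of the second
    -- derivative of `f`.
    have key : ∀ v w, inner ℝ (fderiv ℝ f p v) (fderiv ℝ (unitNormal f) p w)
        = -(inner ℝ (unitNormal f p) (fderiv ℝ (fderiv ℝ f) p w v) : ℝ) := fun v w => by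
      have h1 : HasFDerivAt (fun q => fderiv ℝ f q v) _ p :=
        ((hdf p hp).differentiableAt (by simp)).hasFDerivAt.clm_apply (hasFDerivAt_const v p)
      have h2 := (hNd p hp).hasFDerivAt.inner ℝ h1
      have h3 : HasFDerivAt (fun q => (inner ℝ (unitNormal f q) (fderiv ℝ f q v) : ℝ))
          (0 : Plane →L[ℝ] ℝ) p := by
        refine (hasFDerivAt_const (0 : ℝ) p).congr_of_eventuallyEq ?_
        filter_upwards [hD.mem_nhds hp] with q hq using inner_unitNormal_fderiv (hd q hq) v
      have h4 := congrArg (fun L : Plane →L[ℝ] ℝ => L w) (h2.unique h3)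
      simp at h4
      rw [real_inner_comm]
      linarith
    intro v w
    have hs : IsSymmSndFDerivAt ℝ f p := (hf2 p hp).isSymmSndFDerivAt (by simp)
    rw [key, key, hs.eq]
  have hNo : ∀ p ∈ D, ∀ v,
      inner ℝ (unitNormal f p) (fderiv ℝ (unitNormal f) p v) = (0 : ℝ) := fun p hp v =>
    inner_fderiv_eq_zero (hNd p hp)
      (by filter_upwards [hD.mem_nhds hp] with q hq using inner_unitNormal_self (hc0 q hq)) v
  refine ⟨hf1, hN, fun p hp => inner_unitNormal_self (hc0 p hp), hreg,
    fun p hp v => inner_unitNormal_fderiv (hd p hp) v, hsymm, fun p hp v w => ?_⟩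
  have hn1 := inner_unitNormal_self (hc0 p hp)
  -- Both cross products are multiples of `ν`, say `k ν` and `g ν`. By Lagrange's identity `k g = ℓ
  -- n - m²`, which is `-g²` since `K = -1` and `E G - F² = g²`.
  have hbase : cross (dx (unitNormal f) p) (dy (unitNormal f) p) = -cross (dx f p) (dy f p) := by
    have e1 := cross_eq_norm_smul (hc0 p hp)
    have e2 := cross_eq_smul hn1 (hNo p hp (1, 0)) (hNo p hp (0, 1))
    rw [← dx_eq_fderiv (hNd p hp), ← dy_eq_fderiv (hNd p hp)] at e2
    set g := ‖cross (dx f p) (dy f p)‖ with hg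
    set k : ℝ := inner ℝ (unitNormal f p)
      (cross (dx (unitNormal f) p) (dy (unitNormal f) p))
    have hg0 : g ≠ 0 := norm_ne_zero_iff.2 (hc0 p hp)
    have e3 := inner_cross_cross (dx (unitNormal f) p) (dy (unitNormal f) p) (dx f p) (dy f p)
    rw [e1, e2, inner_smul_left, inner_smul_right, hn1] at e3
    have e4 := hK p hp
    have e5 := norm_cross_sq (dx f p) (dy f p)
    rw [← hg] at e5
    have e6 : coeffE f p * coeffG f p - coeffF f p ^ 2 = g ^ 2 := e5.symm
    rw [gaussCurvature, e6, div_eq_iff (pow_ne_zero 2 hg0)] at e4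
    have e7 := hsymm p hp (1, 0) (0, 1)
    rw [← dx_eq_fderiv (hd p hp), ← dy_eq_fderiv (hd p hp), ← dx_eq_fderiv (hNd p hp),
      ← dy_eq_fderiv (hNd p hp)] at e7
    simp only [coeffL, coeffM, coeffN] at e4
    rw [real_inner_comm (dx f p), real_inner_comm (dy f p) (dy _ _),
      real_inner_comm (dy f p) (dx _ _), real_inner_comm (dx f p) (dy _ _)] at e3
    rw [← e7] at e3
    have e8 : k * g = -g ^ 2 := by
      have : (starRingEnd ℝ) k * (g * 1) = k * g := by simp
      rw [this] at e3
      rw [e3]; linarith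
    have e9 : k = -g := by
      apply mul_right_cancel₀ hg0; rw [e8]; ring
    rw [e2, e1, e9, neg_smul]
  have expand : ∀ h : Plane → Space, DifferentiableAt ℝ h p →
      cross (fderiv ℝ h p v) (fderiv ℝ h p w)
        = (v.1 * w.2 - v.2 * w.1) • cross (dx h p) (dy h p) := fun h hh => by
    rw [fderiv_plane_apply hh v, fderiv_plane_apply hh w]
    simp only [cross_add_left, cross_add_right, cross_smul_left, cross_smul_right, cross_self]
    rw [cross_comm (dy h p) (dx h p)]
    module
  rw [expand _ (hNd p hp), expand _ (hd p hp), hbase, smul_neg]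

/-! ### Asymptotic parametrizations -/

/-- In an asymptotic parametrization, `m² = ‖f_x × f_y‖²` and the Lelieuvre equations hold. -/
lemma IsPair.asymptotic {f : Plane → Space} {U : Set Plane} (h : IsPair f (PseudoSph.unitNormal f) U)
    (hU : IsOpen U) {p : Plane} (hp : p ∈ U) (hl : coeffL f p = 0) (hn : coeffN f p = 0) :
    coeffM f p ^ 2 = ‖cross (dx f p) (dy f p)‖ ^ 2 ∧
    ∀ σ : ℝ, σ * σ = 1 → coeffM f p = σ * ‖cross (dx f p) (dy f p)‖ →
      dx (PseudoSph.unitNormal f) p = -(σ • cross (PseudoSph.unitNormal f p) (dx f p)) ∧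
      dy (PseudoSph.unitNormal f) p = σ • cross (PseudoSph.unitNormal f p) (dy f p) ∧
      dx f p = σ • cross (PseudoSph.unitNormal f p) (dx (PseudoSph.unitNormal f) p) ∧
      dy f p = -(σ • cross (PseudoSph.unitNormal f p) (dy (PseudoSph.unitNormal f) p)) := by
  have hc0 := cross_dx_dy_ne_zero (h.diff_fst hp) (h.injective p hp)
  have e1 := cross_eq_norm_smul hc0
  have hn1 := inner_unitNormal_self hc0
  have hd := h.diff_fst hp
  have hNd := h.diff_snd hp
  have hfx := h.orth p hp (1, 0)
  have hfy := h.orth p hp (0, 1)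
  have hNx := h.orth_snd hU hp (1, 0)
  have hNy := h.orth_snd hU hp (0, 1)
  have hs := h.symm p hp (1, 0) (0, 1)
  have hcr := h.cross_eq p hp (1, 0) (0, 1)
  simp only [coeffL, coeffM, coeffN] at *
  rw [← dx_eq_fderiv hd] at hfx hs hcr
  rw [← dy_eq_fderiv hd] at hfy hs hcr
  rw [← dx_eq_fderiv hNd] at hNx hs hcr
  rw [← dy_eq_fderiv hNd] at hNy hs hcr
  set g := ‖cross (dx f p) (dy f p)‖ with hg
  have hg0 : g ≠ 0 := norm_ne_zero_iff.2 hc0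
  set n := PseudoSph.unitNormal f p
  set a := dx f p
  set b := dy f p
  set a' := dx (PseudoSph.unitNormal f) p
  set b' := dy (PseudoSph.unitNormal f) p
  have hl' : inner ℝ a a' = (0 : ℝ) := neg_eq_zero.1 hl
  have hn' : inner ℝ b b' = (0 : ℝ) := neg_eq_zero.1 hn
  -- Lagrange's identity with `ℓ = n = 0` gives `-g² = -m²`.
  have e3 := inner_cross_cross a' b' a b
  rw [hcr, e1, inner_neg_left, inner_smul_left, inner_smul_right, hn1, real_inner_comm a,
    real_inner_comm b b', real_inner_comm b a', real_inner_comm a b', hl', hn', ← hs] at e3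
  simp only [conj_trivial] at e3
  refine ⟨by nlinarith, fun σ hσ hm => ?_⟩
  have hnab : inner ℝ n (cross a b) = g := by rw [e1, inner_smul_right, hn1, mul_one]
  -- The difference of the two sides is orthogonal to `ν`, `f_x` and `f_y`. The same holds for `hy`.
  have hx : a' = -(σ • cross n a) := by
    rw [← sub_eq_zero, sub_neg_eq_add]
    refine eq_zero_of_orthogonal hn1 e1 hg0 ?_ ?_ ?_
    · rw [inner_add_left, inner_smul_left, inner_cross_self, real_inner_comm, hNx]; simp
    · rw [inner_add_left, inner_smul_left, inner_cross_other, real_inner_comm, hl']; simp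
    · rw [inner_add_left, inner_smul_left, inner_cross_left, hnab, real_inner_comm, ← hs]
      simp only [conj_trivial]; linarith
  have hy : b' = σ • cross n b := by
    rw [← sub_eq_zero]
    refine eq_zero_of_orthogonal hn1 e1 hg0 ?_ ?_ ?_
    · rw [inner_sub_left, inner_smul_left, inner_cross_self, real_inner_comm, hNy]; simp
    · rw [inner_sub_left, inner_smul_left, inner_cross_left, cross_comm b a, inner_neg_right,
        hnab, real_inner_comm]
      simp only [conj_trivial]; linarith
    · rw [inner_sub_left, inner_smul_left, inner_cross_other, real_inner_comm, hn']; simp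
  refine ⟨hx, hy, ?_, ?_⟩
  · rw [hx, cross_neg_right, cross_smul_right, cross_rot_twice hn1 hfx, smul_neg, smul_neg,
      smul_neg, neg_neg, smul_smul, hσ, one_smul]
  · rw [hy, cross_smul_right, cross_rot_twice hn1 hfy, smul_neg, smul_neg, smul_smul, hσ,
      one_smul, neg_neg]

lemma dx_eventuallyEq {g h : Plane → Space} {p : Plane} (e : g =ᶠ[𝓝 p] h) :
    dx g =ᶠ[𝓝 p] dx h := e.eventuallyEq_nhds.mono fun _ hq => dx_congr hq

lemma dy_eventuallyEq {g h : Plane → Space} {p : Plane} (e : g =ᶠ[𝓝 p] h) :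
    dy g =ᶠ[𝓝 p] dy h := e.eventuallyEq_nhds.mono fun _ hq => dy_congr hq

lemma IsC1M.congr {g h : Plane → Space} {U : Set Plane} (H : IsC1M g U) (hU : IsOpen U)
    (e : EqOn h g U) : IsC1M h U := by
  have ee : ∀ p ∈ U, h =ᶠ[𝓝 p] g := fun p hp => e.eventuallyEq_of_mem (hU.mem_nhds hp)
  have exy : EqOn (dy (dx h)) (dy (dx g)) U := fun p hp => dy_congr (dx_eventuallyEq (ee p hp))
  have eyx : EqOn (dx (dy h)) (dx (dy g)) U := fun p hp => dx_congr (dy_eventuallyEq (ee p hp))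
  exact {
    contDiffOn := H.contDiffOn.congr e
    exists_xy := fun p hp => (H.exists_xy p hp).congr_of_eventuallyEq
      (eventually_slice_snd (dx_eventuallyEq (ee p hp)))
    exists_yx := fun p hp => (H.exists_yx p hp).congr_of_eventuallyEq
      (eventually_slice_fst (dy_eventuallyEq (ee p hp)))
    continuousOn_xy := H.continuousOn_xy.congr exy
    continuousOn_yx := H.continuousOn_yx.congr eyx
    xy_eq_yx := fun p hp => by rw [exy hp, eyx hp, H.xy_eq_yx p hp] }

/-- A `C^1` map whose mixed partial derivatives exist and agree with a continuous map. -/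
lemma isC1M_of_hasDerivAt {g k : Plane → Space} {U : Set Plane}
    (hg : ∀ p ∈ U, ContDiffAt ℝ 1 g p) (hk : ContinuousOn k U)
    (hxy : ∀ p ∈ U, HasDerivAt (fun t : ℝ => dx g (p.1, t)) (k p) p.2)
    (hyx : ∀ p ∈ U, HasDerivAt (fun t : ℝ => dy g (t, p.2)) (k p) p.1) : IsC1M g U where
  contDiffOn p hp := (hg p hp).contDiffWithinAt
  exists_xy p hp := (hxy p hp).differentiableAt
  exists_yx p hp := (hyx p hp).differentiableAt
  continuousOn_xy := hk.congr fun p hp => (hxy p hp).deriv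
  continuousOn_yx := hk.congr fun p hp => (hyx p hp).deriv
  xy_eq_yx p hp := (hxy p hp).deriv.trans (hyx p hp).deriv.symm

/-- An asymptotic parametrization of a pseudospherical pair whose normal is `f_x × f_y / ‖·‖`. -/
structure IsAsymptoticPair (f : Plane → Space) (U : Set Plane) : Prop where
  isOpen : IsOpen U
  isPair : IsPair f (unitNormal f) U
  asymptotic : IsAsymptoticOn f U

namespace IsAsymptoticPair

variable {f : Plane → Space} {U : Set Plane}

lemma cross_ne_zero (h : IsAsymptoticPair f U) {p : Plane} (hp : p ∈ U) :
    cross (dx f p) (dy f p) ≠ 0 :=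
  cross_dx_dy_ne_zero (h.isPair.diff_fst hp) (h.isPair.injective p hp)

lemma continuousAt_coeffM (h : IsAsymptoticPair f U) {p : Plane} (hp : p ∈ U) :
    ContinuousAt (coeffM f) p :=
  ((continuousAt_dx (h.isPair.contDiffAt_fst p hp)).inner
    (continuousAt_dy (h.isPair.contDiffAt_snd p hp))).neg

lemma coeffM_ne_zero (h : IsAsymptoticPair f U) {p : Plane} (hp : p ∈ U) : coeffM f p ≠ 0 := by
  intro h0
  have := (h.isPair.asymptotic h.isOpen hp (h.asymptotic p hp).1 (h.asymptotic p hp).2).1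
  rw [h0] at this
  have h1 := norm_ne_zero_iff.2 (h.cross_ne_zero hp)
  exact pow_ne_zero 2 h1 (by rw [← this]; norm_num)

lemma coeffM_of_pos (h : IsAsymptoticPair f U) {p : Plane} (hp : p ∈ U) (h0 : 0 < coeffM f p) :
    coeffM f p = ‖cross (dx f p) (dy f p)‖ := by
  have := (h.isPair.asymptotic h.isOpen hp (h.asymptotic p hp).1 (h.asymptotic p hp).2).1
  nlinarith [norm_nonneg (cross (dx f p) (dy f p))]

lemma coeffM_of_neg (h : IsAsymptoticPair f U) {p : Plane} (hp : p ∈ U) (h0 : coeffM f p < 0) :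
    coeffM f p = -‖cross (dx f p) (dy f p)‖ := by
  have := (h.isPair.asymptotic h.isOpen hp (h.asymptotic p hp).1 (h.asymptotic p hp).2).1
  nlinarith [norm_nonneg (cross (dx f p) (dy f p))]

/-- `m` is continuous and never zero, so its sign is constant near each point. A global sign is not
available, since `U` need not be connected. -/
lemma exists_sign (h : IsAsymptoticPair f U) {p : Plane} (hp : p ∈ U) :
    ∃ σ : ℝ, σ * σ = 1 ∧
      ∀ᶠ q in 𝓝 p, q ∈ U ∧ coeffM f q = σ * ‖cross (dx f q) (dy f q)‖ := by
  rcases lt_or_gt_of_ne (h.coeffM_ne_zero hp) with h0 | h0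
  · refine ⟨-1, by norm_num, ?_⟩
    filter_upwards [h.isOpen.mem_nhds hp,
      (h.continuousAt_coeffM hp).eventually (gt_mem_nhds h0)] with q hq hq0
    exact ⟨hq, by rw [h.coeffM_of_neg hq hq0]; ring⟩
  · refine ⟨1, by norm_num, ?_⟩
    filter_upwards [h.isOpen.mem_nhds hp,
      (h.continuousAt_coeffM hp).eventually (lt_mem_nhds h0)] with q hq hq0
    exact ⟨hq, by rw [h.coeffM_of_pos hq hq0]; ring⟩

/-- The Lelieuvre equations near a point, with their consequences for the mixed derivatives. -/
lemma lelieuvre (h : IsAsymptoticPair f U) {p : Plane} (hp : p ∈ U) :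
    ∃ σ : ℝ, σ * σ = 1 ∧ coeffM f p = σ * ‖cross (dx f p) (dy f p)‖ ∧
      (∀ᶠ q in 𝓝 p, dx (unitNormal f) q = -(σ • cross (unitNormal f q) (dx f q)) ∧
        dy (unitNormal f) q = σ • cross (unitNormal f q) (dy f q)) ∧
      dx f p = σ • cross (unitNormal f p) (dx (unitNormal f) p) ∧
      dy f p = -(σ • cross (unitNormal f p) (dy (unitNormal f) p)) ∧
      HasDerivAt (fun t : ℝ => dx f (p.1, t)) (coeffM f p • unitNormal f p) p.2 ∧
      HasDerivAt (fun t : ℝ => dy f (t, p.2)) (coeffM f p • unitNormal f p) p.1 := by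
  obtain ⟨σ, hσ, hev⟩ := h.exists_sign hp
  have hall := hev.mono fun q hq => (h.isPair.asymptotic h.isOpen hq.1 (h.asymptotic q hq.1).1
    (h.asymptotic q hq.1).2).2 σ hσ hq.2
  have hp' := hall.self_of_nhds
  -- `ν_y × ν_x = f_x × f_y` by the curvature condition, and `m = σ ‖f_x × f_y‖`.
  have hm : σ • cross (dy (unitNormal f) p) (dx (unitNormal f) p)
      = coeffM f p • unitNormal f p := by
    have hcr := h.isPair.cross_eq p hp (0, 1) (1, 0)
    rw [← dx_eq_fderiv (h.isPair.diff_fst hp), ← dy_eq_fderiv (h.isPair.diff_fst hp),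
      ← dx_eq_fderiv (h.isPair.diff_snd hp), ← dy_eq_fderiv (h.isPair.diff_snd hp)] at hcr
    rw [hcr, ← cross_comm, cross_eq_norm_smul (h.cross_ne_zero hp), smul_smul,
      hev.self_of_nhds.2]
  refine ⟨σ, hσ, hev.self_of_nhds.2, hall.mono fun q hq => ⟨hq.1, hq.2.1⟩, hp'.2.2.1, hp'.2.2.2,
    ?_, ?_⟩
  · rw [← hm]
    exact hasDerivAt_dx_of_lelieuvre (h.isPair.contDiffAt_fst p hp) (h.isPair.contDiffAt_snd p hp)
      (hall.mono fun q hq => hq.2.2.1) (hall.mono fun q hq => hq.2.2.2)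
  · rw [← hm]
    exact hasDerivAt_dy_of_lelieuvre (h.isPair.contDiffAt_fst p hp) (h.isPair.contDiffAt_snd p hp)
      (hall.mono fun q hq => hq.2.2.1) (hall.mono fun q hq => hq.2.2.2)

lemma isC1M (h : IsAsymptoticPair f U) : IsC1M f U := by
  refine isC1M_of_hasDerivAt (k := fun p => coeffM f p • unitNormal f p)
    h.isPair.contDiffAt_fst (fun p hp => ?_) (fun p hp => ?_) (fun p hp => ?_)
  · exact ((h.continuousAt_coeffM hp).smul
      (h.isPair.contDiffAt_snd p hp).continuousAt).continuousWithinAt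
  · obtain ⟨σ, -, -, -, -, -, h1, -⟩ := h.lelieuvre hp; exact h1
  · obtain ⟨σ, -, -, -, -, -, -, h1⟩ := h.lelieuvre hp; exact h1

/-- Differentiate `N_x = -σ N × f_x` in `y`. The term `N × f_xy` vanishes because `f_xy` is a
multiple of `N`, and `N_y = σ N × f_y` leaves `-(N × f_y) × f_x = ⟨f_x, f_y⟩ N`. The other order is
analogous. -/
lemma hasDerivAt_normal (h : IsAsymptoticPair f U) {p : Plane} (hp : p ∈ U) :
    HasDerivAt (fun t : ℝ => dx (unitNormal f) (p.1, t)) (coeffF f p • unitNormal f p) p.2 ∧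
    HasDerivAt (fun t : ℝ => dy (unitNormal f) (t, p.2)) (coeffF f p • unitNormal f p) p.1 := by
  obtain ⟨σ, hσ, -, hN, hx, hy, hxy, hyx⟩ := h.lelieuvre hp
  have hNp := hN.self_of_nhds
  have ox := h.isPair.orth p hp (1, 0)
  have oy := h.isPair.orth p hp (0, 1)
  rw [← dx_eq_fderiv (h.isPair.diff_fst hp)] at ox
  rw [← dy_eq_fderiv (h.isPair.diff_fst hp)] at oy
  constructor
  · have h1 := (((hasDerivAt_dy (h.isPair.diff_snd hp)).cross hxy).const_smul σ).neg
    refine (h1.congr_deriv ?_).congr_of_eventuallyEq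
      (eventually_slice_snd (hN.mono fun q hq => hq.1))
    rw [cross_smul_right, cross_self, smul_zero, zero_add, hNp.2, cross_smul_left, smul_smul, hσ,
      one_smul, cross_cross_left, ox, coeffF, real_inner_comm (dx f p)]
    simp
  · have h1 := ((hasDerivAt_dx (h.isPair.diff_snd hp)).cross hyx).const_smul σ
    refine (h1.congr_deriv ?_).congr_of_eventuallyEq
      (eventually_slice_fst (hN.mono fun q hq => hq.2))
    rw [cross_smul_right, cross_self, smul_zero, zero_add, hNp.1, cross_neg_left, cross_smul_left,
      smul_neg, smul_smul, hσ, one_smul, cross_cross_left, oy, coeffF]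
    simp

lemma isC1M_normal (h : IsAsymptoticPair f U) : IsC1M (unitNormal f) U := by
  refine isC1M_of_hasDerivAt (k := fun p => coeffF f p • unitNormal f p)
    h.isPair.contDiffAt_snd (fun p hp => ?_) (fun p hp => (h.hasDerivAt_normal hp).1)
    (fun p hp => (h.hasDerivAt_normal hp).2)
  have hF : ContinuousAt (coeffF f) p :=
    (continuousAt_dx (h.isPair.contDiffAt_fst p hp)).inner
      (continuousAt_dy (h.isPair.contDiffAt_fst p hp))
  exact (hF.smul (h.isPair.contDiffAt_snd p hp).continuousAt).continuousWithinAt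

end IsAsymptoticPair

/-! ### The angle of a Chebyshev parametrization and the interchange of coordinates -/

lemma norm_eq_one_of_inner_self {a : Space} (h : inner ℝ a a = (1 : ℝ)) : ‖a‖ = 1 := by
  rw [real_inner_self_eq_norm_sq (F := Space)] at h
  nlinarith [norm_nonneg a]

lemma cos_theta {f : Plane → Space} {p : Plane} (hE : coeffE f p = 1) (hG : coeffG f p = 1) :
    Real.cos (theta f p) = coeffF f p := by
  rw [theta, InnerProductGeometry.cos_angle, norm_eq_one_of_inner_self hE,
    norm_eq_one_of_inner_self hG, mul_one, div_one, coeffF]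

lemma sin_theta {f : Plane → Space} {p : Plane} (hE : coeffE f p = 1) (hG : coeffG f p = 1) :
    Real.sin (theta f p) = ‖cross (dx f p) (dy f p)‖ := by
  have h1 := norm_cross_sq (dx f p) (dy f p)
  rw [← coeffE, ← coeffF, ← coeffG, hE, hG, ← cos_theta hE hG] at h1
  have h2 := Real.sin_sq_add_cos_sq (theta f p)
  have h3 : 0 ≤ Real.sin (theta f p) := InnerProductGeometry.sin_angle_nonneg _ _
  rw [← sq_eq_sq₀ h3 (norm_nonneg _)]
  linarith

/-- The interchange reverses the unit normal. It also turns `⟨f_x, N_y⟩` into `⟨f_y, N_x⟩`, which is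
equal by symmetry, so only the sign of the normal remains. -/
lemma coeffM_comp_swap {f : Plane → Space} {U : Set Plane} (h : IsPair f (unitNormal f) U)
    {q : Plane} (hq : q.swap ∈ U) :
    coeffM (f ∘ Prod.swap) q = -coeffM f q.swap := by
  have e : unitNormal (f ∘ Prod.swap) = (fun p => -unitNormal f p) ∘ Prod.swap := by
    funext p
    simp only [unitNormal, dx_comp_swap, dy_comp_swap, Function.comp_apply]
    rw [cross_comm, norm_neg, smul_neg]
  have hs := h.symm q.swap hq (1, 0) (0, 1)
  rw [← dx_eq_fderiv (h.diff_fst hq), ← dy_eq_fderiv (h.diff_fst hq),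
    ← dx_eq_fderiv (h.diff_snd hq), ← dy_eq_fderiv (h.diff_snd hq)] at hs
  have hneg : dx (fun p => -unitNormal f p) q.swap = -dx (unitNormal f) q.swap :=
    (hasDerivAt_dx (h.diff_snd hq)).neg.deriv
  rw [coeffM, coeffM, e, dx_comp_swap, dy_comp_swap, hneg, inner_neg_right, hs]

/-! ### The inverse function theorem in the plane -/

lemma exists_isC1Diffeo {Ψ : Plane → Plane} {p : Plane} (h : ContDiffAt ℝ 1 Ψ p)
    (hi : Function.Injective (fderiv ℝ Ψ p)) {V : Set Plane} (hV : V ∈ 𝓝 p) :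
    ∃ e : OpenPartialHomeomorph Plane Plane,
      IsC1Diffeo e ∧ p ∈ e.source ∧ e.source ⊆ V ∧ ⇑e = Ψ := by
  let L : Plane ≃L[ℝ] Plane :=
    (LinearEquiv.ofInjectiveEndo (fderiv ℝ Ψ p : Plane →ₗ[ℝ] Plane) hi).toContinuousLinearEquiv
  have hL : (L : Plane →L[ℝ] Plane) = fderiv ℝ Ψ p := by ext <;> rfl
  have hd : HasFDerivAt Ψ (L : Plane →L[ℝ] Plane) p := by
    rw [hL]; exact (h.differentiableAt (by simp)).hasFDerivAt
  have hgood : ∀ᶠ q in 𝓝 p, q ∈ V ∧ ContDiffAt ℝ 1 Ψ q ∧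
      fderiv ℝ Ψ q ∈ range ((↑) : (Plane ≃L[ℝ] Plane) → Plane →L[ℝ] Plane) := by
    refine (show ∀ᶠ q in 𝓝 p, q ∈ V from hV).and ((h.eventually (by simp)).and ?_)
    have hc : ContinuousAt (fderiv ℝ Ψ) p := h.continuousAt_fderiv (by simp)
    refine hc.eventually ?_
    rw [← hL]
    exact ContinuousLinearEquiv.nhds L
  let e0 := h.toOpenPartialHomeomorph Ψ hd (by simp)
  have he0 : ⇑e0 = Ψ := rfl
  -- For the inverse to be `C^1` on the whole target, the differential must be invertible at every
  -- point of the source and not only at `p`. Invertible operators form an open set, so shrinking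
  -- achieves this.
  let e := e0.restrOpen (interior {q | q ∈ V ∧ ContDiffAt ℝ 1 Ψ q ∧
      fderiv ℝ Ψ q ∈ range ((↑) : (Plane ≃L[ℝ] Plane) → Plane →L[ℝ] Plane)}) isOpen_interior
  have hes : ∀ q ∈ e.source, q ∈ V ∧ ContDiffAt ℝ 1 Ψ q ∧
      fderiv ℝ Ψ q ∈ range ((↑) : (Plane ≃L[ℝ] Plane) → Plane →L[ℝ] Plane) := fun q hq =>
    (interior_subset (s := {q | q ∈ V ∧ ContDiffAt ℝ 1 Ψ q ∧
      fderiv ℝ Ψ q ∈ range ((↑) : (Plane ≃L[ℝ] Plane) → Plane →L[ℝ] Plane)})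
      (e0.restrOpen_source _ isOpen_interior ▸ hq : q ∈ e0.source ∩ _).2 :)
  refine ⟨e, ⟨fun q hq => (hes q hq).2.1.contDiffWithinAt, fun y hy => ?_⟩, ?_,
    fun q hq => (hes q hq).1, rfl⟩
  · obtain ⟨-, h1, M, hM⟩ := hes _ (e.map_target hy)
    refine (e.contDiffAt_symm (f₀' := M) hy ?_ h1).contDiffWithinAt
    rw [hM]
    exact (h1.differentiableAt (by simp)).hasFDerivAt
  · rw [e0.restrOpen_source _ isOpen_interior]
    exact ⟨h.mem_toOpenPartialHomeomorph_source hd (by simp), mem_interior_iff_mem_nhds.2 hgood⟩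

lemma contDiffAt_one_of_eventually {E F : Type*} [NormedAddCommGroup E] [NormedSpace ℝ E]
    [NormedAddCommGroup F] [NormedSpace ℝ F] {g : E → F} {g' : E → E →L[ℝ] F} {p : E}
    (h : ∀ᶠ q in 𝓝 p, HasFDerivAt g (g' q) q) (hc : ∀ᶠ q in 𝓝 p, ContinuousAt g' q) :
    ContDiffAt ℝ 1 g p := by
  rw [contDiffAt_one_iff]
  exact ⟨g', {q | HasFDerivAt g (g' q) q ∧ ContinuousAt g' q}, h.and hc,
    fun q hq => hq.2.continuousWithinAt, fun q hq => hq.1⟩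

/-! ### First integrals of scalar ordinary differential equations -/

/-- Compact support makes the coefficient bounded and globally Lipschitz, as needed for solving the
differential equation on a time interval of fixed length. -/
lemma exists_contDiff_hasCompactSupport {a : Plane → ℝ} {p : Plane} (ha : ContDiffAt ℝ 1 a p) :
    ∃ b : Plane → ℝ, ContDiff ℝ 1 b ∧ HasCompactSupport b ∧ b =ᶠ[𝓝 p] a := by
  obtain ⟨ε, hε, hball⟩ := Metric.eventually_nhds_iff_ball.1 (ha.eventually (by simp))
  let φ : ContDiffBump p := ⟨ε / 4, ε / 2, by linarith, by linarith⟩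
  refine ⟨fun q => φ q * a q, contDiff_iff_contDiffAt.2 fun q => ?_,
    φ.hasCompactSupport.mul_right, ?_⟩
  · by_cases hq : q ∈ tsupport φ
    · rw [φ.tsupport_eq] at hq
      refine φ.contDiff.contDiffAt.mul (hball q ?_)
      exact Metric.closedBall_subset_ball (show ε / 2 < ε by linarith) hq
    · refine contDiffAt_const.congr_of_eventuallyEq (f := fun _ => (0 : ℝ)) ?_
      filter_upwards [notMem_tsupport_iff_eventuallyEq.1 hq] with u hu
      simp [hu]
  · filter_upwards [φ.eventuallyEq_one] with q hq
    simp [hq]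

/-- `R (ρ, t)` is the solution of `dr/dt = -b (r, t)` with value `ρ` at time `p.2`; its graph is an
integral curve of the kernel of `dr + b dt`. -/
lemma exists_scalar_flow {b : Plane → ℝ} (hb : ContDiff ℝ 1 b) (hc : HasCompactSupport b)
    (p : Plane) : ∃ R : Plane → ℝ, Continuous R ∧ ∀ ρ ∈ Ioo (p.1 - 1) (p.1 + 1),
      R (ρ, p.2) = ρ ∧ ∀ t ∈ Ioo (p.2 - 1) (p.2 + 1),
        HasDerivAt (fun t => R (ρ, t)) (-b (R (ρ, t), t)) t := by
  obtain ⟨M, hM⟩ := hc.exists_bound_of_continuous hb.continuous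
  obtain ⟨K, hK⟩ := hb.lipschitzWith_of_hasCompactSupport hc (by simp)
  have hM0 : 0 ≤ M := (norm_nonneg _).trans (hM p)
  lift M to NNReal using hM0
  have ht0 : p.2 ∈ Icc (p.2 - 1) (p.2 + 1) := by constructor <;> linarith
  -- Starting within `1` of `p.1` and moving at speed at most `M` for time at most `1`, a solution
  -- stays within `M + 1`.
  have hPL : IsPicardLindelof (fun t x => -b (x, t)) (tmin := p.2 - 1) (tmax := p.2 + 1)
      ⟨p.2, ht0⟩ p.1 (M + 1) 1 M K := by
    refine ⟨fun t _ => ?_, fun x _ => ?_, fun t _ x _ => ?_, ?_⟩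
    · refine LipschitzWith.lipschitzOnWith (LipschitzWith.of_dist_le_mul fun x y => ?_)
      rw [dist_neg_neg]
      refine (hK.dist_le_mul _ _).trans (le_of_eq ?_)
      simp [Prod.dist_eq]
    · exact (hb.continuous.comp (Continuous.prodMk_right x)).neg.continuousOn
    · rw [norm_neg]; exact hM _
    · simp
  obtain ⟨α, h1, h2⟩ := hPL.exists_forall_mem_closedBall_eq_hasDerivWithinAt_continuousOn
  have hbl : Metric.closedBall p.1 ((1 : NNReal) : ℝ) = Icc (p.1 - 1) (p.1 + 1) := by
    rw [Real.closedBall_eq_Icc]; simp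
  rw [hbl] at h1 h2
  have hle1 : p.1 - 1 ≤ p.1 + 1 := by linarith
  have hle2 : p.2 - 1 ≤ p.2 + 1 := by linarith
  -- Clamping to the closed square extends the flow to a function continuous on the whole plane.
  let π : Plane → Plane := fun q =>
    (projIcc (p.1 - 1) (p.1 + 1) hle1 q.1, projIcc (p.2 - 1) (p.2 + 1) hle2 q.2)
  have hπc : Continuous π := by
    refine Continuous.prodMk ?_ ?_
    · exact continuous_subtype_val.comp (continuous_projIcc.comp continuous_fst)
    · exact continuous_subtype_val.comp (continuous_projIcc.comp continuous_snd)
  have hπ : ∀ ρ ∈ Icc (p.1 - 1) (p.1 + 1), ∀ t ∈ Icc (p.2 - 1) (p.2 + 1), π (ρ, t) = (ρ, t) :=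
    fun ρ hρ t ht => by simp only [π, projIcc_of_mem hle1 hρ, projIcc_of_mem hle2 ht]
  refine ⟨α ∘ π, h2.comp_continuous hπc fun q => ⟨Subtype.coe_prop _, Subtype.coe_prop _⟩,
    fun ρ hρ => ⟨?_, fun t ht => ?_⟩⟩
  · rw [Function.comp_apply, hπ ρ (Ioo_subset_Icc_self hρ) _ ht0]
    exact (h1 ρ (Ioo_subset_Icc_self hρ)).1
  · have h3 := ((h1 ρ (Ioo_subset_Icc_self hρ)).2 t (Ioo_subset_Icc_self ht)).hasDerivAt
      (Icc_mem_nhds ht.1 ht.2)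
    rw [Function.comp_apply, hπ ρ (Ioo_subset_Icc_self hρ) _ (Ioo_subset_Icc_self ht)]
    refine h3.congr_of_eventuallyEq ?_
    filter_upwards [Icc_mem_nhds ht.1 ht.2] with s hs
    rw [Function.comp_apply, hπ ρ (Ioo_subset_Icc_self hρ) _ hs]

/-- Hadamard's lemma: the difference quotient in the first variable of a `C^1` function extends
continuously to the diagonal. -/
lemma exists_continuous_diffQuot {b : Plane → ℝ} (hb : ContDiff ℝ 1 b) :
    ∃ q : ℝ × ℝ × ℝ → ℝ, Continuous q ∧
      ∀ x y t, b (x, t) - b (y, t) = q (x, y, t) * (x - y) := by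
  have hbc : Continuous fun u : Plane => fderiv ℝ b u (1, 0) :=
    (hb.continuous_fderiv (by simp)).clm_apply continuous_const
  refine ⟨fun u => ∫ θ in (0 : ℝ)..1, fderiv ℝ b (u.2.1 + θ * (u.1 - u.2.1), u.2.2) (1, 0), ?_, ?_⟩
  · refine intervalIntegral.continuous_parametric_intervalIntegral_of_continuous' ?_ 0 1
    exact hbc.comp (by fun_prop : Continuous fun v : (ℝ × ℝ × ℝ) × ℝ =>
      ((v.1.2.1 + v.2 * (v.1.1 - v.1.2.1), v.1.2.2) : Plane))
  · intro x y t
    have hd : ∀ θ : ℝ, HasDerivAt (fun θ : ℝ => b (y + θ * (x - y), t))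
        (fderiv ℝ b (y + θ * (x - y), t) (1, 0) * (x - y)) θ := fun θ => by
      have h1 := hasDerivAt_slice_fst (p := (y + θ * (x - y), t))
        ((hb.differentiable (by simp)) (y + θ * (x - y), t)).hasFDerivAt
      have h2 : HasDerivAt (fun θ : ℝ => y + θ * (x - y)) (x - y) θ := by
        simpa using ((hasDerivAt_id θ).mul_const (x - y)).const_add y
      exact HasDerivAt.comp θ (h₂ := fun s : ℝ => b (s, t)) h1 h2
    have h3 := intervalIntegral.integral_eq_sub_of_hasDerivAt (a := 0) (b := 1)
      (fun θ _ => hd θ) (Continuous.intervalIntegrable (by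
        refine Continuous.mul (hbc.comp (g := fun u : Plane => fderiv ℝ b u (1, 0))
          (f := fun θ : ℝ => ((y + θ * (x - y), t) : Plane)) (by fun_prop)) continuous_const) _ _)
    rw [intervalIntegral.integral_mul_const] at h3
    simp only [one_mul, zero_mul, add_zero, add_sub_cancel] at h3
    exact h3.symm

/-- Differentiability in the initial value comes from an explicit formula. By Hadamard's lemma the
difference of two solutions satisfies a linear scalar equation, so it equals `(x - y)` times an
exponential that extends continuously to `x = y`. -/
lemma exists_scalar_flow_deriv {b : Plane → ℝ} (hb : ContDiff ℝ 1 b) (hc : HasCompactSupport b)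
    (p : Plane) : ∃ R E : Plane → ℝ, Continuous R ∧ Continuous E ∧ (∀ u, 0 < E u) ∧ R p = p.1 ∧
      ∀ u ∈ Ioo (p.1 - 1) (p.1 + 1) ×ˢ Ioo (p.2 - 1) (p.2 + 1),
        HasFDerivAt R (E u • ContinuousLinearMap.fst ℝ ℝ ℝ
          + (-b (R u, u.2)) • ContinuousLinearMap.snd ℝ ℝ ℝ) u := by
  obtain ⟨R, hRc, hR⟩ := exists_scalar_flow hb hc p
  obtain ⟨q, hqc, hq⟩ := exists_continuous_diffQuot hb
  have hkc : Continuous fun z : (ℝ × ℝ × ℝ) × ℝ =>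
      q (R (z.1.1, z.2), R (z.1.2.1, z.2), z.2) := by fun_prop
  let P : ℝ × ℝ × ℝ → ℝ := fun w => ∫ σ in p.2..w.2.2, q (R (w.1, σ), R (w.2.1, σ), σ)
  have hPc : Continuous P :=
    intervalIntegral.continuous_parametric_intervalIntegral_of_continuous
      (f := fun w : ℝ × ℝ × ℝ => fun σ => q (R (w.1, σ), R (w.2.1, σ), σ)) hkc (by fun_prop)
  have hp2 : p.2 ∈ Ioo (p.2 - 1) (p.2 + 1) := by constructor <;> linarith
  have hp1 : p.1 ∈ Ioo (p.1 - 1) (p.1 + 1) := by constructor <;> linarith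
  have hdiff : ∀ x ∈ Ioo (p.1 - 1) (p.1 + 1), ∀ y ∈ Ioo (p.1 - 1) (p.1 + 1),
      ∀ t ∈ Ioo (p.2 - 1) (p.2 + 1),
      R (x, t) - R (y, t) = Real.exp (-P (x, y, t)) * (x - y) := by
    intro x hx y hy t ht
    -- `exp P` is the integrating factor of the linear equation for the difference.
    have hd : ∀ s ∈ Ioo (p.2 - 1) (p.2 + 1),
        HasDerivAt (fun s => (R (x, s) - R (y, s)) * Real.exp (P (x, y, s))) 0 s := by
      intro s hs
      have h1 := ((hR x hx).2 s hs).sub ((hR y hy).2 s hs)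
      have hkc' : Continuous fun σ => q (R (x, σ), R (y, σ), σ) := by fun_prop
      have h2 : HasDerivAt (fun s => P (x, y, s)) (q (R (x, s), R (y, s), s)) s :=
        intervalIntegral.integral_hasDerivAt_right (hkc'.intervalIntegrable _ _)
          (hkc'.stronglyMeasurableAtFilter _ _) hkc'.continuousAt
      refine (h1.mul h2.exp).congr_deriv ?_
      have h3 := hq (R (x, s)) (R (y, s)) s
      simp only [Pi.sub_apply]
      linear_combination (-Real.exp (P (x, y, s))) * h3
    have h4 := isOpen_Ioo.is_const_of_deriv_eq_zero isPreconnected_Ioo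
      (fun s hs => (hd s hs).differentiableAt.differentiableWithinAt)
      (fun s hs => (hd s hs).deriv) ht hp2
    simp only [(hR x hx).1, (hR y hy).1] at h4
    have h5 : P (x, y, p.2) = 0 := intervalIntegral.integral_same
    rw [h5, Real.exp_zero, mul_one] at h4
    rw [← h4, Real.exp_neg]
    field_simp
  let E : Plane → ℝ := fun u => Real.exp (-P (u.1, u.1, u.2))
  have hEc : Continuous E := by fun_prop
  refine ⟨R, E, hRc, hEc, fun u => Real.exp_pos _, (hR p.1 hp1).1, fun u hu => ?_⟩
  have hopen : IsOpen (Ioo (p.1 - 1) (p.1 + 1) ×ˢ Ioo (p.2 - 1) (p.2 + 1)) :=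
    isOpen_Ioo.prod isOpen_Ioo
  have h1 : ∀ v ∈ Ioo (p.1 - 1) (p.1 + 1) ×ˢ Ioo (p.2 - 1) (p.2 + 1),
      HasDerivAt (fun x => R (x, v.2)) (E v) v.1 := by
    intro v hv
    rw [hasDerivAt_iff_tendsto_slope]
    have hl : Tendsto (fun x => Real.exp (-P (x, v.1, v.2))) (𝓝[≠] v.1) (𝓝 (E v)) := by
      have : Continuous fun x => Real.exp (-P (x, v.1, v.2)) := by fun_prop
      exact (this.tendsto v.1).mono_left nhdsWithin_le_nhds
    refine hl.congr' ?_
    filter_upwards [self_mem_nhdsWithin, mem_nhdsWithin_of_mem_nhds (isOpen_Ioo.mem_nhds hv.1)]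
      with x hx hxI
    have hne : x - v.1 ≠ 0 := sub_ne_zero.2 hx
    rw [slope_def_field, hdiff x hxI v.1 hv.1 v.2 hv.2]
    field_simp
  -- Both partial derivatives of `R` exist near `u` and are continuous, hence `R` is differentiable
  -- there.
  have key := hasStrictFDerivAt_uncurry_coprod (𝕜 := ℝ) (u := u) (f := fun x t => R (x, t))
    (f₁ := fun x t => E (x, t) • ContinuousLinearMap.id ℝ ℝ)
    (f₂ := fun x t => (-b (R (x, t), t)) • ContinuousLinearMap.id ℝ ℝ)
    (by
      filter_upwards [hopen.mem_nhds hu] with v hv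
      refine (h1 v hv).hasFDerivAt.congr_fderiv ?_
      ext; simp [Function.HasUncurry.uncurry])
    (by
      filter_upwards [hopen.mem_nhds hu] with v hv
      refine ((hR v.1 hv.1).2 v.2 hv.2).hasFDerivAt.congr_fderiv ?_
      ext; simp [Function.HasUncurry.uncurry])
    (by
      refine Continuous.continuousAt ?_
      change Continuous fun v : Plane => E (v.1, v.2) • ContinuousLinearMap.id ℝ ℝ
      fun_prop)
    (by
      refine Continuous.continuousAt ?_
      have := hb.continuous
      change Continuous fun v : Plane => (-b (R (v.1, v.2), v.2)) • ContinuousLinearMap.id ℝ ℝ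
      fun_prop)
  refine key.hasFDerivAt.congr_fderiv ?_
  ext <;> simp [Function.HasUncurry.uncurry]

/-- A continuous 1-form `dr + a ds` with `a` of class `C^1` has a `C^1` first integral. -/
lemma exists_first_integral {a : Plane → ℝ} {p : Plane} (ha : ContDiffAt ℝ 1 a p) :
    ∃ φ : Plane → ℝ, ContDiffAt ℝ 1 φ p ∧
      ∀ᶠ q in 𝓝 p, ∃ μ : ℝ, μ ≠ 0 ∧ ∀ v, fderiv ℝ φ q v = μ * (v.1 + a q * v.2) := by
  obtain ⟨b, hb, hbc, hba⟩ := exists_contDiff_hasCompactSupport ha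
  obtain ⟨R, E, hRc, hEc, hE, hRp, hR⟩ := exists_scalar_flow_deriv hb hbc p
  set V := Ioo (p.1 - 1) (p.1 + 1) ×ˢ Ioo (p.2 - 1) (p.2 + 1) with hV
  have hVo : IsOpen V := isOpen_Ioo.prod isOpen_Ioo
  have hpV : p ∈ V := by
    refine ⟨⟨?_, ?_⟩, ⟨?_, ?_⟩⟩ <;> simp
  -- `G` sends initial value and time to the point reached. The first component of its inverse
  -- recovers the initial value, which is constant along solutions and so is the first integral.
  let G : Plane → Plane := fun u => (R u, u.2)
  let G' : Plane → Plane →L[ℝ] Plane := fun u =>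
    (E u • ContinuousLinearMap.fst ℝ ℝ ℝ
          + (-b (R u, u.2)) • ContinuousLinearMap.snd ℝ ℝ ℝ).prod (ContinuousLinearMap.snd ℝ ℝ ℝ)
  have hG : ∀ u ∈ V, HasFDerivAt G (G' u) u := fun u hu => (hR u hu).prodMk hasFDerivAt_snd
  have hGp : G p = p := by simp [G, hRp]
  have hRC : ContDiffAt ℝ 1 R p := contDiffAt_one_of_eventually
    (by filter_upwards [hVo.mem_nhds hpV] with u hu using hR u hu)
    (Eventually.of_forall fun u => by
      have := hb.continuous
      exact Continuous.continuousAt (by fun_prop))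
  have hGC : ContDiffAt ℝ 1 G p := hRC.prodMk contDiffAt_snd
  have hi : Function.Injective (fderiv ℝ G p) := by
    rw [(hG p hpV).fderiv, injective_iff_map_eq_zero]
    rintro ⟨v1, v2⟩ hv
    simp only [G', ContinuousLinearMap.prod_apply, add_apply,
      smul_apply, ContinuousLinearMap.coe_fst', ContinuousLinearMap.coe_snd',
      smul_eq_mul, Prod.mk_eq_zero] at hv
    obtain ⟨h1, rfl⟩ := hv
    simp only [mul_zero, add_zero, mul_eq_zero, (hE p).ne', false_or] at h1
    simp [h1]
  obtain ⟨e, he, hpe, heV, heG⟩ := exists_isC1Diffeo hGC hi (hVo.mem_nhds hpV)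
  have hpt : p ∈ e.target := by
    have := e.map_source hpe
    rwa [heG, hGp] at this
  have hφ : ∀ q ∈ e.target, ContDiffAt ℝ 1 (fun q => (e.symm q).1) q := fun q hq =>
    contDiffAt_fst.comp q (he.contDiffAt_symm hq)
  refine ⟨fun q => (e.symm q).1, hφ p hpt, ?_⟩
  filter_upwards [e.open_target.mem_nhds hpt, hba] with q hq hqa
  set u := e.symm q with hu
  have hus : u ∈ e.source := e.map_target hq
  have hGu : G u = q := by rw [← heG]; exact e.right_inv hq
  have h1 := ((hφ q hq).differentiableAt (by simp)).hasFDerivAt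
  set L := fderiv ℝ (fun q => (e.symm q).1) q
  rw [← hGu] at h1
  have h2 := h1.comp u (hG u (heV hus))
  have h3 : HasFDerivAt ((fun q => (e.symm q).1) ∘ G) (ContinuousLinearMap.fst ℝ ℝ ℝ) u := by
    refine hasFDerivAt_fst.congr_of_eventuallyEq ?_
    filter_upwards [e.eventually_left_inverse hus] with w hw
    rw [heG] at hw
    simp [hw]
  have h4 := h2.unique h3
  have hb' : b (R u, u.2) = a q := by
    rw [show ((R u, u.2) : Plane) = q from hGu, hqa]
  have hL : ∀ v : Plane, L v = v.1 * L (1, 0) + v.2 * L (0, 1) := fun v => by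
    rw [← smul_eq_mul, ← smul_eq_mul, ← map_smul, ← map_smul, ← map_add]; simp
  -- On the two basis vectors, `L ∘ dG = fst` reads `E L(1,0) = 1` and `L(0,1) = a L(1,0)`. The
  -- factor `μ` is therefore `L(1,0) ≠ 0`.
  have e1 := congrArg (fun M : Plane →L[ℝ] ℝ => M (1, 0)) h4
  have e2 := congrArg (fun M : Plane →L[ℝ] ℝ => M (0, 1)) h4
  simp only [ContinuousLinearMap.comp_apply, G', ContinuousLinearMap.prod_apply,
    add_apply, smul_apply, ContinuousLinearMap.coe_fst',
    ContinuousLinearMap.coe_snd', hb'] at e1 e2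
  rw [hL] at e1 e2
  simp only [smul_eq_mul, mul_one, mul_zero, add_zero, zero_add, one_mul, zero_mul] at e1 e2
  refine ⟨L (1, 0), fun h0 => ?_, fun v => ?_⟩
  · rw [h0, mul_zero] at e1; exact zero_ne_one e1
  · rw [hL v]
    linear_combination v.2 * e2

/-! ### Characteristic coordinates of a pseudospherical pair -/

namespace IsPair

variable {f N : Plane → Space} {U : Set Plane}

/-- The form `df + σ N × dN`, `σ = ±1`, has rank at most one. -/
lemma cross_form (h : IsPair f N U) (hU : IsOpen U) {p : Plane} (hp : p ∈ U) {σ : ℝ}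
    (hσ : σ * σ = 1) (v w : Plane) :
    cross (fderiv ℝ f p v + σ • cross (N p) (fderiv ℝ N p v))
      (fderiv ℝ f p w + σ • cross (N p) (fderiv ℝ N p w)) = 0 := by
  have h1 := cross_rot_rot (h.inner_self p hp) (h.orth_snd hU hp v) (h.orth_snd hU hp w)
  simp only [cross_add_left, cross_add_right, cross_smul_left, cross_smul_right, smul_add,
    smul_smul, hσ, one_smul, h1, h.cross_eq p hp v w]
  -- The pure terms cancel by the curvature condition. The mixed terms are multiples of `N` whose
  -- coefficients cancel by symmetry of the second fundamental form.
  rw [cross_cross_right, cross_cross_left, h.symm p hp v w, real_inner_comm (N p), h.orth p hp v,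
    h.orth p hp w, real_inner_comm (fderiv ℝ f p w) (fderiv ℝ N p v)]
  module

/-- If `df = -σ N × dN`, then `df × df = dN × dN = -df × df` because the rotation `N ×` preserves
cross products of tangent vectors. This contradicts the rank of `df`. -/
lemma exists_form_ne_zero (h : IsPair f N U) (hU : IsOpen U) {p : Plane} (hp : p ∈ U) {σ : ℝ}
    (hσ : σ * σ = 1) : ∃ v, fderiv ℝ f p v + σ • cross (N p) (fderiv ℝ N p v) ≠ 0 := by
  by_contra! H
  have e : ∀ v, fderiv ℝ f p v = -(σ • cross (N p) (fderiv ℝ N p v)) := fun v =>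
    eq_neg_of_add_eq_zero_left (H v)
  have h1 := cross_rot_rot (h.inner_self p hp) (h.orth_snd hU hp (1, 0)) (h.orth_snd hU hp (0, 1))
  have h2 : cross (fderiv ℝ f p (1, 0)) (fderiv ℝ f p (0, 1))
      = -cross (fderiv ℝ f p (1, 0)) (fderiv ℝ f p (0, 1)) := by
    conv_lhs => rw [e, e]
    rw [cross_neg_left, cross_neg_right, neg_neg, cross_smul_left, cross_smul_right, smul_smul, hσ,
      one_smul, h1, h.cross_eq p hp]
  have h3 := cross_dx_dy_ne_zero (h.diff_fst hp) (h.injective p hp)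
  rw [dx_eq_fderiv (h.diff_fst hp), dy_eq_fderiv (h.diff_fst hp)] at h3
  have h4 : (2 : ℝ) • cross (fderiv ℝ f p (1, 0)) (fderiv ℝ f p (0, 1)) = 0 := by
    rw [two_smul]
    nth_rewrite 1 [h2]
    exact neg_add_cancel _
  exact h3 ((smul_eq_zero.1 h4).resolve_left two_ne_zero)

/-- A vector killed by a nonzero component of the rank one form is killed by the form. -/
lemma form_eq_zero (h : IsPair f N U) (hU : IsOpen U) {p : Plane} (hp : p ∈ U) {σ : ℝ}
    (hσ : σ * σ = 1) {c : Space} {v w : Plane}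
    (hw : inner ℝ c (fderiv ℝ f p w + σ • cross (N p) (fderiv ℝ N p w)) ≠ (0 : ℝ))
    (hv : inner ℝ c (fderiv ℝ f p v + σ • cross (N p) (fderiv ℝ N p v)) = (0 : ℝ)) :
    fderiv ℝ f p v + σ • cross (N p) (fderiv ℝ N p v) = 0 := by
  have h1 := congrArg (cross c) (h.cross_form hU hp hσ v w)
  rw [cross_zero_right, cross_cross_right, hv, zero_smul, sub_zero] at h1
  exact (smul_eq_zero.1 h1).resolve_left hw

/-- There is a direction in the tangent plane whose components of both rank one forms are
nonzero. -/
lemma exists_direction (h : IsPair f N U) (hU : IsOpen U) {p : Plane} (hp : p ∈ U) :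
    ∃ c : Space, inner ℝ (N p) c = (0 : ℝ) ∧ ∀ σ : ℝ, σ = 1 ∨ σ = -1 →
      ∃ w, inner ℝ c (fderiv ℝ f p w + σ • cross (N p) (fderiv ℝ N p w)) ≠ (0 : ℝ) := by
  obtain ⟨v, hv⟩ := h.exists_form_ne_zero hU hp (σ := 1) (by norm_num)
  obtain ⟨w, hw⟩ := h.exists_form_ne_zero hU hp (σ := -1) (by norm_num)
  have ho : ∀ (σ : ℝ) (u : Plane),
      inner ℝ (N p) (fderiv ℝ f p u + σ • cross (N p) (fderiv ℝ N p u)) = (0 : ℝ) := fun σ u => by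
    rw [inner_add_right, inner_smul_right, h.orth p hp, inner_self_cross]; simp
  have ov := ho 1 v
  have ow := ho (-1) w
  set a := fderiv ℝ f p v + (1 : ℝ) • cross (N p) (fderiv ℝ N p v) with ha
  set b := fderiv ℝ f p w + (-1 : ℝ) • cross (N p) (fderiv ℝ N p w) with hb
  have haa : (inner ℝ a a : ℝ) ≠ 0 := inner_self_ne_zero.2 hv
  have hbb : (inner ℝ b b : ℝ) ≠ 0 := inner_self_ne_zero.2 hw
  -- With `a`, `b` nonzero values of the two forms, `a` itself serves unless it is orthogonal to
  -- `b`, in which case `a + b` does.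
  by_cases hab : (inner ℝ a b : ℝ) = 0
  · refine ⟨a + b, by rw [inner_add_right, ov, ow, add_zero], ?_⟩
    rintro σ (rfl | rfl)
    · refine ⟨v, ?_⟩
      rw [← ha, inner_add_left, real_inner_comm a b, hab, add_zero]; exact haa
    · refine ⟨w, ?_⟩
      rw [← hb, inner_add_left, hab, zero_add]; exact hbb
  · refine ⟨a, ov, ?_⟩
    rintro σ (rfl | rfl)
    · exact ⟨v, haa⟩
    · exact ⟨w, hab⟩

/-- The assumptions make the `c`-components of both forms vanish at `v`. By rank one both forms then
vanish at `v`, and their sum is `2 df`. -/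
lemma eq_zero_of_forms (h : IsPair f N U) (hU : IsOpen U) {p : Plane} (hp : p ∈ U) {c : Space}
    (hc : ∀ σ : ℝ, σ = 1 ∨ σ = -1 →
      ∃ w, inner ℝ c (fderiv ℝ f p w + σ • cross (N p) (fderiv ℝ N p w)) ≠ (0 : ℝ)) {v : Plane}
    (h1 : inner ℝ c (fderiv ℝ f p v) = (0 : ℝ))
    (h2 : inner ℝ c (cross (N p) (fderiv ℝ N p v)) = (0 : ℝ)) : v = 0 := by
  have key : ∀ σ : ℝ, σ = 1 ∨ σ = -1 →
      fderiv ℝ f p v + σ • cross (N p) (fderiv ℝ N p v) = 0 := fun σ hσ => by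
    obtain ⟨w, hw⟩ := hc σ hσ
    refine h.form_eq_zero hU hp (by rcases hσ with rfl | rfl <;> norm_num) hw ?_
    rw [inner_add_right, inner_smul_right, h1, h2]; simp
  have k1 := key 1 (Or.inl rfl)
  have k2 := key (-1) (Or.inr rfl)
  have k3 : (2 : ℝ) • fderiv ℝ f p v = 0 := by
    rw [← add_zero (0 : Space)]
    nth_rewrite 1 [← k1]
    rw [← k2]
    module
  have k4 := (smul_eq_zero.1 k3).resolve_left (by norm_num)
  exact h.injective p hp (k4.trans (map_zero _).symm)

/-- Around every point there is a `C^1` map whose components have differentials proportional to a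
component of `df + N × dN` and of `df - N × dN` respectively. -/
lemma exists_characteristic_map (h : IsPair f N U) (hU : IsOpen U) {p : Plane} (hp : p ∈ U) :
    ∃ (c : Space) (Ψ : Plane → Plane), ContDiffAt ℝ 1 Ψ p ∧ Function.Injective (fderiv ℝ Ψ p) ∧
      ∀ᶠ q in 𝓝 p, ∃ μ ν : ℝ, ∀ v, fderiv ℝ Ψ q v =
        (μ * inner ℝ c (fderiv ℝ f q v + (1 : ℝ) • cross (N q) (fderiv ℝ N q v)),
          ν * inner ℝ c (fderiv ℝ f q v + (-1 : ℝ) • cross (N q) (fderiv ℝ N q v))) := by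
  obtain ⟨c, hNc, hc⟩ := h.exists_direction hU hp
  have hn1 := h.inner_self p hp
  set n := N p with hn
  have hnd : cross n (cross c n) = c := by
    rw [cross_cross_right, hn1, hNc]; simp
  let N₁ : Plane → ℝ := fun q => inner ℝ (N q) n
  let N₂ : Plane → ℝ := fun q => inner ℝ (N q) (cross c n)
  -- The second coordinate is a slope of the normal. By the quotient rule and Lagrange's identity
  -- its differential is `⟨c, N × dN⟩ / N₁²`, so `⟨c, df ± N × dN⟩ = dr ± N₁² ds`.
  let S : Plane → Plane := fun q => (inner ℝ c (f q), N₂ q * (N₁ q)⁻¹)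
  have hN₁ : ∀ q ∈ U, ContDiffAt ℝ 1 N₁ q := fun q hq =>
    (h.contDiffAt_snd q hq).inner ℝ contDiffAt_const
  have hN₂ : ∀ q ∈ U, ContDiffAt ℝ 1 N₂ q := fun q hq =>
    (h.contDiffAt_snd q hq).inner ℝ contDiffAt_const
  have hN₁p : N₁ p ≠ 0 := by simp only [N₁]; rw [← hn, hn1]; norm_num
  have hgood : ∀ᶠ q in 𝓝 p, q ∈ U ∧ N₁ q ≠ 0 :=
    (show ∀ᶠ q in 𝓝 p, q ∈ U from hU.mem_nhds hp).and
      ((hN₁ p hp).continuousAt.eventually_ne hN₁p)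
  have hS : ∀ q, q ∈ U ∧ N₁ q ≠ 0 → ContDiffAt ℝ 1 S q := fun q hq =>
    (contDiffAt_const.inner ℝ (h.contDiffAt_fst q hq.1)).prodMk ((hN₂ q hq.1).mul ((hN₁ q hq.1).inv hq.2))
  have hS' : ∀ q, q ∈ U ∧ N₁ q ≠ 0 → ∀ v,
      (fderiv ℝ S q v).1 = inner ℝ c (fderiv ℝ f q v) ∧
      N₁ q ^ 2 * (fderiv ℝ S q v).2 = inner ℝ c (cross (N q) (fderiv ℝ N q v)) := fun q hq v => by
    have d0 := (hasFDerivAt_const c q).inner ℝ (h.diff_fst hq.1).hasFDerivAt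
    have d1 := (h.diff_snd hq.1).hasFDerivAt.inner ℝ (hasFDerivAt_const n q)
    have d2 := (h.diff_snd hq.1).hasFDerivAt.inner ℝ (hasFDerivAt_const (cross c n) q)
    have d3 := d0.prodMk (d2.mul ((hasDerivAt_inv hq.2).comp_hasFDerivAt q d1))
    have e1 : fderiv ℝ S q = _ := d3.fderiv
    rw [e1]
    refine ⟨by simp, ?_⟩
    have hq2 : (inner ℝ (N q) n : ℝ) ≠ 0 := hq.2
    have h3 := inner_cross_cross (N q) (fderiv ℝ N q v) n (cross c n)
    rw [hnd] at h3
    rw [real_inner_comm (cross (N q) (fderiv ℝ N q v)) c, h3]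
    simp [N₁]
    field_simp
    ring
  have hSinj : Function.Injective (fderiv ℝ S p) := by
    rw [injective_iff_map_eq_zero]
    intro v hv
    obtain ⟨e1, e2⟩ := hS' p ⟨hp, hN₁p⟩ v
    rw [hv] at e1 e2
    simp only [Prod.fst_zero, Prod.snd_zero, mul_zero] at e1 e2
    exact h.eq_zero_of_forms hU hp hc e1.symm e2.symm
  obtain ⟨e, he, hpe, heg, heS⟩ := exists_isC1Diffeo (hS p ⟨hp, hN₁p⟩) hSinj hgood
  have hSt : S p ∈ e.target := by rw [← heS]; exact e.map_source hpe
  have hSp : e.symm (S p) = p := by rw [← heS]; exact e.left_inv hpe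
  -- In the coordinates `S` the coefficient involves `N` but not `dN`; this is why it is `C^1`.
  let a : Plane → ℝ := fun u => N₁ (e.symm u) ^ 2
  have ha : ContDiffAt ℝ 1 a (S p) :=
    (ContDiffAt.comp (g := N₁) (S p) (by rw [hSp]; exact hN₁ p hp) (he.contDiffAt_symm hSt)).pow 2
  have haS : ∀ q ∈ e.source, a (S q) = N₁ q ^ 2 := fun q hq => by
    simp only [a]; rw [← heS, e.left_inv hq]
  obtain ⟨φ, hφ, hφ'⟩ := exists_first_integral ha
  obtain ⟨ψ, hψ, hψ'⟩ := exists_first_integral ha.neg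
  have hSc : Tendsto S (𝓝 p) (𝓝 (S p)) := (hS p ⟨hp, hN₁p⟩).continuousAt
  have hΨ : ContDiffAt ℝ 1 (fun q => (φ (S q), ψ (S q))) p :=
    (hφ.comp p (hS p ⟨hp, hN₁p⟩)).prodMk (hψ.comp p (hS p ⟨hp, hN₁p⟩))
  have hform : ∀ᶠ q in 𝓝 p, ∃ μ ν : ℝ, μ ≠ 0 ∧ ν ≠ 0 ∧
      ∀ v, fderiv ℝ (fun q => (φ (S q), ψ (S q))) q v =
        (μ * inner ℝ c (fderiv ℝ f q v + (1 : ℝ) • cross (N q) (fderiv ℝ N q v)),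
          ν * inner ℝ c (fderiv ℝ f q v + (-1 : ℝ) • cross (N q) (fderiv ℝ N q v))) := by
    filter_upwards [e.open_source.mem_nhds hpe, hSc.eventually hφ', hSc.eventually hψ',
      hSc.eventually (hφ.eventually (by simp)), hSc.eventually (hψ.eventually (by simp))]
      with q hq ⟨μ, hμ, e1⟩ ⟨ν, hν, e2⟩ d1 d2
    have dS := ((hS q (heg hq)).differentiableAt (by simp)).hasFDerivAt
    have d := ((d1.differentiableAt (by simp)).hasFDerivAt.comp q dS).prodMk
      ((d2.differentiableAt (by simp)).hasFDerivAt.comp q dS)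
    have d' : fderiv ℝ (fun q => (φ (S q), ψ (S q))) q = _ := d.fderiv
    refine ⟨μ, ν, hμ, hν, fun v => ?_⟩
    obtain ⟨s1, s2⟩ := hS' q (heg hq) v
    rw [d']
    simp only [ContinuousLinearMap.prod_apply, ContinuousLinearMap.comp_apply, e1, e2, haS q hq, neg_mul, s1, s2, inner_add_right, inner_smul_right]
    simp
  refine ⟨c, _, hΨ, ?_, hform.mono fun q ⟨μ, ν, _, _, e⟩ => ⟨μ, ν, e⟩⟩
  obtain ⟨μ, ν, hμ, hν, e⟩ := hform.self_of_nhds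
  rw [injective_iff_map_eq_zero]
  intro v hv
  rw [e, Prod.mk_eq_zero, mul_eq_zero, mul_eq_zero] at hv
  have k1 := hv.1.resolve_left hμ
  have k2 := hv.2.resolve_left hν
  rw [inner_add_right, inner_smul_right] at k1 k2
  exact h.eq_zero_of_forms hU hp hc (by linarith) (by linarith)

end IsPair

lemma IsC1Diffeo.fderiv_symm_apply {e : OpenPartialHomeomorph Plane Plane} (he : IsC1Diffeo e)
    {q : Plane} (hq : q ∈ e.target) (v : Plane) :
    fderiv ℝ e (e.symm q) (fderiv ℝ e.symm q v) = v := by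
  have h1 := ((he.contDiffAt_symm hq).differentiableAt (by simp)).hasFDerivAt
  have h2 := ((he.contDiffAt (e.map_target hq)).differentiableAt (by simp)).hasFDerivAt
  have h4 : HasFDerivAt (e ∘ e.symm) (ContinuousLinearMap.id ℝ Plane) q :=
    (hasFDerivAt_id q).congr_of_eventuallyEq (e.eventually_right_inverse hq)
  exact congrArg (fun L : Plane →L[ℝ] Plane => L v) ((h2.comp q h1).unique h4)

lemma fderiv_comp_symm_apply {e : OpenPartialHomeomorph Plane Plane} (he : IsC1Diffeo e)
    {g : Plane → Space} {q : Plane} (hq : q ∈ e.target) (hg : DifferentiableAt ℝ g (e.symm q))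
    (v : Plane) : fderiv ℝ (g ∘ e.symm) q v = fderiv ℝ g (e.symm q) (fderiv ℝ e.symm q v) := by
  rw [fderiv_comp q hg ((he.contDiffAt_symm hq).differentiableAt (by simp))]; rfl

/-- The Lelieuvre equations `f_x = N × N_x` and `f_y = -N × N_y`. -/
def IsLelieuvre (f N : Plane → Space) (U : Set Plane) : Prop :=
  ∀ q ∈ U, dx f q = cross (N q) (dx N q) ∧ dy f q = -cross (N q) (dy N q)

/-- Every pseudospherical pair satisfies the Lelieuvre equations in suitable local coordinates. -/
lemma IsPair.exists_lelieuvre {f N : Plane → Space} {U : Set Plane} (h : IsPair f N U)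
    (hU : IsOpen U) {p : Plane} (hp : p ∈ U) :
    ∃ e : OpenPartialHomeomorph Plane Plane, IsC1Diffeo e ∧ p ∈ e.source ∧ e.source ⊆ U ∧
      IsLelieuvre (f ∘ e.symm) (N ∘ e.symm) e.target := by
  obtain ⟨c, Ψ, hΨ, hi, hform⟩ := h.exists_characteristic_map hU hp
  obtain ⟨e, he, hpe, heV, heΨ⟩ := exists_isC1Diffeo hΨ hi
    ((show ∀ᶠ q in 𝓝 p, q ∈ U from hU.mem_nhds hp).and hform)
  refine ⟨e, he, hpe, fun q hq => (heV hq).1, fun q hq => ?_⟩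
  have hc := h.comp he.symm (fun q hq => (heV hq).1)
  have hqs : q ∈ e.symm.source := hq
  obtain ⟨hu, μ, ν, hf⟩ := heV (e.map_target hq)
  have k := he.fderiv_symm_apply hq
  rw [heΨ] at k
  have k1 := k (1, 0)
  have k2 := k (0, 1)
  rw [hf, Prod.mk.injEq] at k1 k2
  rw [dx_eq_fderiv (hc.diff_fst hqs), dy_eq_fderiv (hc.diff_fst hqs), dx_eq_fderiv (hc.diff_snd hqs),
    dy_eq_fderiv (hc.diff_snd hqs), fderiv_comp_symm_apply he hq (h.diff_fst hu),
    fderiv_comp_symm_apply he hq (h.diff_fst hu), fderiv_comp_symm_apply he hq (h.diff_snd hu),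
    fderiv_comp_symm_apply he hq (h.diff_snd hu)]
  have hμ : μ ≠ 0 := fun h0 => by have := k1.1; rw [h0, zero_mul] at this; exact zero_ne_one this
  have hν : ν ≠ 0 := fun h0 => by have := k2.2; rw [h0, zero_mul] at this; exact zero_ne_one this
  -- The second characteristic component is `0` on the `x`-direction and `1` on the `y`-direction,
  -- so `ω₋` has rank one and kills the `x`-direction. `z2` is the same for `ω₊` with the directions
  -- exchanged.
  have z1 := h.form_eq_zero hU hu (σ := -1) (by norm_num)
    (right_ne_zero_of_mul (k2.2.symm ▸ one_ne_zero)) ((mul_eq_zero.1 k1.2).resolve_left hν)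
  have z2 := h.form_eq_zero hU hu (σ := 1) (by norm_num)
    (right_ne_zero_of_mul (k1.1.symm ▸ one_ne_zero)) ((mul_eq_zero.1 k2.1).resolve_left hμ)
  rw [neg_one_smul, ← sub_eq_add_neg] at z1
  rw [one_smul] at z2
  exact ⟨sub_eq_zero.1 z1, eq_neg_of_add_eq_zero_left z2⟩

/-! ### Chebyshev coordinates -/

section Rescaling

variable {f N : Plane → Space} {U : Set Plane}

/-- The curvature condition turns `N_y × N_x` into `f_x × f_y`, so the mixed derivative is
orthogonal to both `f_x` and `f_y`. -/
lemma IsLelieuvre.hasDerivAt_mixed (h : IsPair f N U) (hU : IsOpen U) (hL : IsLelieuvre f N U)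
    {p : Plane} (hp : p ∈ U) :
    HasDerivAt (fun t : ℝ => dx f (p.1, t)) (cross (dx f p) (dy f p)) p.2 ∧
    HasDerivAt (fun t : ℝ => dy f (t, p.2)) (cross (dx f p) (dy f p)) p.1 := by
  have hev : ∀ᶠ q in 𝓝 p, q ∈ U := hU.mem_nhds hp
  have hx : ∀ᶠ q in 𝓝 p, dx f q = (1 : ℝ) • cross (N q) (dx N q) :=
    hev.mono fun q hq => by rw [one_smul]; exact (hL q hq).1
  have hy : ∀ᶠ q in 𝓝 p, dy f q = -((1 : ℝ) • cross (N q) (dy N q)) :=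
    hev.mono fun q hq => by rw [one_smul]; exact (hL q hq).2
  have e : cross (dx f p) (dy f p) = (1 : ℝ) • cross (dy N p) (dx N p) := by
    have hcr := h.cross_eq p hp (0, 1) (1, 0)
    rw [← dx_eq_fderiv (h.diff_fst hp), ← dy_eq_fderiv (h.diff_fst hp),
      ← dx_eq_fderiv (h.diff_snd hp), ← dy_eq_fderiv (h.diff_snd hp)] at hcr
    rw [one_smul, hcr, ← cross_comm]
  rw [e]
  exact ⟨hasDerivAt_dx_of_lelieuvre (h.contDiffAt_fst p hp) (h.contDiffAt_snd p hp) hx hy,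
    hasDerivAt_dy_of_lelieuvre (h.contDiffAt_fst p hp) (h.contDiffAt_snd p hp) hx hy⟩

lemma norm_eq_of_inner_deriv_eq_zero {g g' : ℝ → Space} {s : Set ℝ} (hs : IsOpen s)
    (hs' : IsPreconnected s) (hg : ∀ t ∈ s, HasDerivAt g (g' t) t)
    (h0 : ∀ t ∈ s, inner ℝ (g t) (g' t) = (0 : ℝ)) {a b : ℝ} (ha : a ∈ s) (hb : b ∈ s) :
    ‖g a‖ = ‖g b‖ := by
  have hd : ∀ t ∈ s, HasDerivAt (fun t => (inner ℝ (g t) (g t) : ℝ)) 0 t := fun t ht => by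
    refine ((hg t ht).inner ℝ (hg t ht)).congr_deriv ?_
    rw [real_inner_comm (g t) (g' t), h0 t ht, add_zero]
  have h1 := hs.is_const_of_deriv_eq_zero hs'
    (fun t ht => (hd t ht).differentiableAt.differentiableWithinAt)
    (fun t ht => (hd t ht).deriv) ha hb
  simp only [real_inner_self_eq_norm_sq] at h1
  exact (sq_eq_sq₀ (norm_nonneg _) (norm_nonneg _)).1 h1

/-- A continuous function on an open interval has a primitive vanishing at a given point. -/
lemma exists_primitive {A : ℝ → ℝ} {a b c : ℝ} (hA : ContinuousOn A (Ioo a b)) (hc : c ∈ Ioo a b) :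
    ∃ α : ℝ → ℝ, α c = 0 ∧ ∀ x ∈ Ioo a b, HasDerivAt α (A x) x := by
  refine ⟨fun x => ∫ t in c..x, A t, intervalIntegral.integral_same, fun x hx => ?_⟩
  have hsub : uIcc c x ⊆ Ioo a b := ordConnected_Ioo.uIcc_subset hc hx
  exact intervalIntegral.integral_hasDerivAt_right
    ((hA.mono hsub).intervalIntegrable)
    (hA.stronglyMeasurableAtFilter isOpen_Ioo x hx)
    (hA.continuousAt (isOpen_Ioo.mem_nhds hx))

/-- Solutions of the Lelieuvre equations can be rescaled to be Chebyshev. -/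
lemma IsLelieuvre.exists_chebyshev (h : IsPair f N U) (hU : IsOpen U) (hL : IsLelieuvre f N U)
    {p : Plane} (hp : p ∈ U) :
    ∃ e : OpenPartialHomeomorph Plane Plane, IsC1Diffeo e ∧ p ∈ e.source ∧ e.source ⊆ U ∧
      e p = 0 ∧ IsLelieuvre (f ∘ e.symm) (N ∘ e.symm) e.target ∧
      IsChebyshevOn (f ∘ e.symm) e.target := by
  obtain ⟨δ, hδ, hball⟩ := Metric.isOpen_iff.1 hU p hp
  set I := Ioo (p.1 - δ) (p.1 + δ) with hI
  set J := Ioo (p.2 - δ) (p.2 + δ) with hJ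
  have hS : I ×ˢ J ⊆ U := by
    rwa [hI, hJ, ← Real.ball_eq_Ioo, ← Real.ball_eq_Ioo, ball_prod_same]
  have hSo : IsOpen (I ×ˢ J) := isOpen_Ioo.prod isOpen_Ioo
  have hpI : p.1 ∈ I := ⟨by linarith, by linarith⟩
  have hpJ : p.2 ∈ J := ⟨by linarith, by linarith⟩
  have hne : ∀ q ∈ U, dx f q ≠ 0 ∧ dy f q ≠ 0 := fun q hq => by
    have := cross_dx_dy_ne_zero (h.diff_fst hq) (h.injective q hq)
    exact ⟨fun h0 => this (by rw [h0, cross_zero_left]), fun h0 => this (by rw [h0, cross_zero_right])⟩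
  -- `f_xy ⊥ f_x` makes `‖f_x‖` independent of `y` on the square. `hB` is the counterpart for
  -- `‖f_y‖`.
  have hA : ∀ q ∈ I ×ˢ J, ‖dx f q‖ = ‖dx f (q.1, p.2)‖ := fun q hq =>
    norm_eq_of_inner_deriv_eq_zero (g := fun t => dx f (q.1, t)) isOpen_Ioo isPreconnected_Ioo
      (fun t ht => (hL.hasDerivAt_mixed h hU (hS ⟨hq.1, ht⟩ : (q.1, t) ∈ U)).1)
      (fun t _ => inner_self_cross _ _) hq.2 hpJ
  have hB : ∀ q ∈ I ×ˢ J, ‖dy f q‖ = ‖dy f (p.1, q.2)‖ := fun q hq =>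
    norm_eq_of_inner_deriv_eq_zero (g := fun t => dy f (t, q.2)) isOpen_Ioo isPreconnected_Ioo
      (fun t ht => (hL.hasDerivAt_mixed h hU (hS ⟨ht, hq.2⟩ : (t, q.2) ∈ U)).2)
      (fun t _ => inner_other_cross _ _) hq.1 hpI
  have hAc : ContinuousOn (fun x => ‖dx f (x, p.2)‖) I := fun x hx =>
    (ContinuousAt.comp (f := fun x : ℝ => ((x, p.2) : Plane))
      (continuousAt_dx (h.contDiffAt_fst (x, p.2) (hS ⟨hx, hpJ⟩)))
      (Continuous.prodMk_left p.2).continuousAt).norm.continuousWithinAt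
  have hBc : ContinuousOn (fun y => ‖dy f (p.1, y)‖) J := fun y hy =>
    (ContinuousAt.comp (f := fun y : ℝ => ((p.1, y) : Plane))
      (continuousAt_dy (h.contDiffAt_fst (p.1, y) (hS ⟨hpI, hy⟩)))
      (Continuous.prodMk_right p.1).continuousAt).norm.continuousWithinAt
  -- The new coordinates are the arc lengths along the two coordinate lines through `p`.
  obtain ⟨α, hα0, hα⟩ := exists_primitive hAc hpI
  obtain ⟨β, hβ0, hβ⟩ := exists_primitive hBc hpJ
  let Ψ : Plane → Plane := fun q => (α q.1, β q.2)
  let L : Plane → Plane →L[ℝ] Plane := fun q =>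
    (‖dx f (q.1, p.2)‖ • ContinuousLinearMap.fst ℝ ℝ ℝ).prod
      (‖dy f (p.1, q.2)‖ • ContinuousLinearMap.snd ℝ ℝ ℝ)
  have hα' : ∀ q ∈ I ×ˢ J, HasFDerivAt (fun q : Plane => α q.1)
      (‖dx f (q.1, p.2)‖ • ContinuousLinearMap.fst ℝ ℝ ℝ) q := fun q hq =>
    (hα q.1 hq.1).comp_hasFDerivAt q hasFDerivAt_fst
  have hβ' : ∀ q ∈ I ×ˢ J, HasFDerivAt (fun q : Plane => β q.2)
      (‖dy f (p.1, q.2)‖ • ContinuousLinearMap.snd ℝ ℝ ℝ) q := fun q hq =>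
    (hβ q.2 hq.2).comp_hasFDerivAt q hasFDerivAt_snd
  have hΨ' : ∀ q ∈ I ×ˢ J, HasFDerivAt Ψ (L q) q := fun q hq => (hα' q hq).prodMk (hβ' q hq)
  have hpS : p ∈ I ×ˢ J := ⟨hpI, hpJ⟩
  have hev : ∀ᶠ q in 𝓝 p, q ∈ I ×ˢ J := hSo.mem_nhds hpS
  have hΨ : ContDiffAt ℝ 1 Ψ p := by
    refine ContDiffAt.prodMk (contDiffAt_one_of_eventually (hev.mono hα') (hev.mono fun q hq => ?_))
      (contDiffAt_one_of_eventually (hev.mono hβ') (hev.mono fun q hq => ?_))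
    · exact ((hAc.continuousAt (isOpen_Ioo.mem_nhds hq.1)).comp continuousAt_fst).smul
        continuousAt_const
    · exact ((hBc.continuousAt (isOpen_Ioo.mem_nhds hq.2)).comp continuousAt_snd).smul
        continuousAt_const
  have hi : Function.Injective (fderiv ℝ Ψ p) := by
    rw [(hΨ' p hpS).fderiv, injective_iff_map_eq_zero]
    rintro ⟨v1, v2⟩ hv
    have h1 := norm_ne_zero_iff.2 (hne p hp).1
    have h2 := norm_ne_zero_iff.2 (hne p hp).2
    simp only [L, ContinuousLinearMap.prod_apply, smul_apply, ContinuousLinearMap.coe_fst',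
      ContinuousLinearMap.coe_snd', smul_eq_mul, Prod.mk_eq_zero, mul_eq_zero] at hv
    exact Prod.ext (hv.1.resolve_left h1) (hv.2.resolve_left h2)
  obtain ⟨e, he, hpe, heS, heΨ⟩ := exists_isC1Diffeo hΨ hi (hSo.mem_nhds hpS)
  have hpart : ∀ q ∈ e.target, ∀ g : Plane → Space, DifferentiableAt ℝ g (e.symm q) →
      dx (g ∘ e.symm) q = ‖dx f (e.symm q)‖⁻¹ • dx g (e.symm q) ∧
      dy (g ∘ e.symm) q = ‖dy f (e.symm q)‖⁻¹ • dy g (e.symm q) := fun q hq g hg => by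
    have hus := heS (e.map_target hq)
    have h1 := norm_ne_zero_iff.2 (hne _ (hS hus)).1
    have h2 := norm_ne_zero_iff.2 (hne _ (hS hus)).2
    have k := he.fderiv_symm_apply hq
    rw [heΨ, (hΨ' _ hus).fderiv] at k
    have k1 := k (1, 0)
    have k2 := k (0, 1)
    simp only [L, ContinuousLinearMap.prod_apply, smul_apply, ContinuousLinearMap.coe_fst',
      ContinuousLinearMap.coe_snd', smul_eq_mul, Prod.mk.injEq, ← hA _ hus, ← hB _ hus] at k1 k2
    have hd := hg.comp q ((he.contDiffAt_symm hq).differentiableAt (by simp))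
    rw [dx_eq_fderiv hd, dy_eq_fderiv hd, fderiv_comp_symm_apply he hq hg,
      fderiv_comp_symm_apply he hq hg, fderiv_plane_apply hg, fderiv_plane_apply hg,
      (mul_eq_zero.1 k1.2).resolve_left h2, (mul_eq_zero.1 k2.1).resolve_left h1,
      eq_inv_of_mul_eq_one_right k1.1, eq_inv_of_mul_eq_one_right k2.2]
    simp
  have hmem : ∀ q ∈ e.target, e.symm q ∈ U := fun q hq => hS (heS (e.map_target hq))
  refine ⟨e, he, hpe, fun q hq => hS (heS hq), ?_, fun q hq => ?_, fun q hq => ?_⟩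
  · rw [heΨ]; simp [Ψ, hα0, hβ0]
  · obtain ⟨f1, f2⟩ := hpart q hq f (h.diff_fst (hmem q hq))
    obtain ⟨n1, n2⟩ := hpart q hq N (h.diff_snd (hmem q hq))
    rw [f1, f2, n1, n2, Function.comp_apply, cross_smul_right, cross_smul_right, ← smul_neg]
    exact ⟨congrArg _ (hL _ (hmem q hq)).1, congrArg _ (hL _ (hmem q hq)).2⟩
  · obtain ⟨f1, f2⟩ := hpart q hq f (h.diff_fst (hmem q hq))
    have h1 := norm_ne_zero_iff.2 (hne _ (hmem q hq)).1
    have h2 := norm_ne_zero_iff.2 (hne _ (hmem q hq)).2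
    rw [coeffE, coeffG, f1, f2, real_inner_self_eq_norm_sq, real_inner_self_eq_norm_sq, norm_smul,
      norm_smul, norm_inv, norm_inv, norm_norm, norm_norm, inv_mul_cancel₀ h1, inv_mul_cancel₀ h2]
    simp

end Rescaling

/-- The Lelieuvre equations imply that the parametrization is asymptotic with `m > 0`. -/
lemma IsLelieuvre.asymptotic {f N : Plane → Space} {U : Set Plane} (h : IsPair f N U)
    (hU : IsOpen U) (hL : IsLelieuvre f N U) {q : Plane} (hq : q ∈ U) :
    (coeffL f q = 0 ∧ coeffN f q = 0) ∧ 0 < coeffM f q := by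
  obtain ⟨ε, hε, he⟩ := h.unitNormal_eventuallyEq hU hq
  have hx : dx (unitNormal f) q = ε • dx N q := by
    rw [dx_congr he]; exact ((hasDerivAt_dx (h.diff_snd hq)).const_smul ε).deriv
  have hy : dy (unitNormal f) q = ε • dy N q := by
    rw [dy_congr he]; exact ((hasDerivAt_dy (h.diff_snd hq)).const_smul ε).deriv
  obtain ⟨l1, l2⟩ := hL q hq
  have hny := h.orth_snd hU hq (0, 1)
  rw [← dy_eq_fderiv (h.diff_snd hq)] at hny
  refine ⟨⟨?_, ?_⟩, ?_⟩
  · rw [coeffL, hx, inner_smul_right, l1, inner_cross_other]; simp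
  · rw [coeffN, hy, inner_smul_right, l2, inner_neg_left, inner_cross_other]; simp
  · have hc0 := cross_dx_dy_ne_zero (h.diff_fst hq) (h.injective q hq)
    have h1 : cross (N q) (dy f q) = dy N q := by
      rw [l2, cross_neg_right, cross_rot_twice (h.inner_self q hq) hny, neg_neg]
    have h2 : coeffM f q = ‖cross (dx f q) (dy f q)‖ := by
      have h3 : (inner ℝ (unitNormal f q) (cross (dx f q) (dy f q)) : ℝ)
          = ‖cross (dx f q) (dy f q)‖ := by
        nth_rewrite 1 [cross_eq_norm_smul hc0]
        rw [inner_smul_right, inner_unitNormal_self hc0, mul_one]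
      -- `m = -ε ⟨f_x, N × f_y⟩ = ⟨ν, f_x × f_y⟩` with `ν = ε N`, so positivity does not depend on
      -- the sign `ε`.
      rw [← h3, coeffM, hy, inner_smul_right, ← h1, he.self_of_nhds, inner_smul_left,
        inner_cross_rotate, cross_comm (dy f q), inner_neg_right]
      simp
    rw [h2]
    exact norm_pos_iff.2 hc0

/-! ### Existence of positively labelled asymptotic Chebyshev coordinates -/

/-- A pseudospherical pair has asymptotic Chebyshev coordinates around every point. -/
lemma IsPair.exists_asymptoticChebyshevChange {f N : Plane → Space} {D : Set Plane}
    (h : IsPair f N D) (hD : IsOpen D) {p : Plane} (hp : p ∈ D) :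
    ∃ T : OpenPartialHomeomorph Plane Plane, ∃ ε : ℝ,
      0 < ε ∧ T.source = Ioo (-ε) ε ×ˢ Ioo (-ε) ε ∧ T (0, 0) = p ∧
      IsAsymptoticChebyshevChange f D T ∧ IsPositivelyLabelledOn (f ∘ T) T.source := by
  obtain ⟨e₁, he₁, hp₁, hs₁, hL₁⟩ := h.exists_lelieuvre hD hp
  have h₁ : IsPair (f ∘ e₁.symm) (N ∘ e₁.symm) e₁.target := h.comp he₁.symm hs₁
  obtain ⟨e₂, he₂, hp₂, hs₂, h0, hL₂, hC₂⟩ :=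
    hL₁.exists_chebyshev h₁ e₁.open_target (e₁.map_source hp₁)
  have h₂ : IsPair ((f ∘ e₁.symm) ∘ e₂.symm) ((N ∘ e₁.symm) ∘ e₂.symm) e₂.target :=
    h₁.comp he₂.symm hs₂
  have h0t : (0 : Plane) ∈ e₂.target := h0 ▸ e₂.map_source hp₂
  obtain ⟨ε, hε, hball⟩ := Metric.isOpen_iff.1 e₂.open_target 0 h0t
  have hQ : Ioo (-ε) ε ×ˢ Ioo (-ε) ε ⊆ e₂.target := by
    have e0 : Ioo (-ε) ε = Metric.ball (0 : ℝ) ε := by rw [Real.ball_eq_Ioo]; simp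
    rw [e0, ball_prod_same]
    exact hball
  have hQo : IsOpen (Ioo (-ε) ε ×ˢ Ioo (-ε) ε) := isOpen_Ioo.prod isOpen_Ioo
  -- Since `e₂.source ⊆ e₁.target`, the composite is defined on all of `e₂.target`, which contains
  -- the square.
  let T := (e₂.symm.trans e₁.symm).restrOpen _ hQo
  have hT : IsC1Diffeo T := (he₂.symm.trans he₁.symm).restrOpen hQo
  have hTs : T.source = Ioo (-ε) ε ×ˢ Ioo (-ε) ε := by
    simp only [T]
    rw [OpenPartialHomeomorph.restrOpen_source, OpenPartialHomeomorph.trans_source]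
    refine inter_eq_right.2 fun q hq => ⟨hQ hq, ?_⟩
    exact hs₂ (e₂.map_target (hQ hq))
  have hTQ : T.source ⊆ e₂.target := hTs ▸ hQ
  refine ⟨T, ε, hε, hTs, ?_, ⟨fun q hq => ?_, hT.contDiffOn, hT.contDiffOn_symm, fun q hq => ?_,
    fun q hq => hC₂ q (hTQ hq)⟩, fun q hq => ?_⟩
  · change e₁.symm (e₂.symm 0) = p
    rw [← h0, e₂.left_inv hp₂, e₁.left_inv hp₁]
  · have hu := T.map_target hq
    rw [← T.right_inv hq]
    exact hs₁ (e₁.map_target (hs₂ (e₂.map_target (hTQ hu))))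
  · exact (hL₂.asymptotic h₂ e₂.open_target (hTQ hq)).1
  · exact (hL₂.asymptotic h₂ e₂.open_target (hTQ hq)).2

/-! ### The sign of `m` and the proof of the theorem -/

lemma normalAC_eq_unitNormal {f : Plane → Space} {p : Plane} (hE : coeffE f p = 1)
    (hG : coeffG f p = 1) : normalAC f p = unitNormal f p := by
  rw [normalAC, unitNormal, sin_theta hE hG]

/-- On a preconnected set `m` has constant sign. -/
lemma IsAsymptoticPair.coeffM_pos_or_neg {f : Plane → Space} {U : Set Plane}
    (h : IsAsymptoticPair f U) (hU : IsPreconnected U) :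
    (∀ p ∈ U, 0 < coeffM f p) ∨ ∀ p ∈ U, coeffM f p < 0 := by
  by_contra! H
  obtain ⟨⟨p, hp, hp0⟩, q, hq, hq0⟩ := H
  obtain ⟨r, hr, hr0⟩ := hU.intermediate_value hp hq
    (fun r hr => (h.continuousAt_coeffM hr).continuousWithinAt) ⟨hp0, hq0⟩
  exact h.coeffM_ne_zero hr hr0

lemma IsAsymptoticPair.lelieuvre_of_pos {f : Plane → Space} {U : Set Plane}
    (h : IsAsymptoticPair f U) {p : Plane} (hp : p ∈ U) (h0 : 0 < coeffM f p) :
    dy (dx f) p = ‖cross (dx f p) (dy f p)‖ • unitNormal f p ∧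
      dx f p = cross (unitNormal f p) (dx (unitNormal f) p) ∧
      dy f p = -cross (unitNormal f p) (dy (unitNormal f) p) := by
  obtain ⟨σ, -, hm, -, hx, hy, hxy, -⟩ := h.lelieuvre hp
  have hg := norm_pos_iff.2 (h.cross_ne_zero hp)
  have hσ : σ = 1 := by
    rw [h.coeffM_of_pos hp h0] at hm
    exact (mul_right_cancel₀ hg.ne' ((one_mul _).trans hm)).symm
  rw [hσ, one_smul] at hx hy
  refine ⟨?_, hx, hy⟩
  rw [← h.coeffM_of_pos hp h0]
  exact hxy.deriv

end PseudoSph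

end

theorem mainTheorem7 (D : Set PseudoSph.Plane) (hD : IsOpen D)
    (f₀ : PseudoSph.Plane → PseudoSph.Space)
    (hf₀ : ContDiffOn ℝ 2 f₀ D)
    (hreg : PseudoSph.IsRegularOn f₀ D)
    (hK : ∀ p ∈ D, PseudoSph.gaussCurvature f₀ p = -1) :
    -- positively labelled asymptotic Chebyshev coordinates exist around every point
    (∀ p ∈ D, ∃ T : OpenPartialHomeomorph PseudoSph.Plane PseudoSph.Plane, ∃ ε : ℝ,
      0 < ε ∧ T.source = Set.Ioo (-ε) ε ×ˢ Set.Ioo (-ε) ε ∧ T (0, 0) = p ∧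
      PseudoSph.IsAsymptoticChebyshevChange f₀ D T ∧
      PseudoSph.IsPositivelyLabelledOn (f₀ ∘ T) T.source) ∧
    -- and all asymptotic Chebyshev coordinates have the stated properties
    (∀ T : OpenPartialHomeomorph PseudoSph.Plane PseudoSph.Plane,
      PseudoSph.IsAsymptoticChebyshevChange f₀ D T →
      ∀ (f N : PseudoSph.Plane → PseudoSph.Space) (θ : PseudoSph.Plane → ℝ),
        f = f₀ ∘ T → θ = PseudoSph.theta f → N = PseudoSph.normalAC f →
        PseudoSph.IsC1M f T.source ∧
        (∀ q ∈ T.source, 0 < θ q ∧ θ q < Real.pi) ∧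
        PseudoSph.IsC1M N T.source ∧
        (∀ q ∈ T.source,
          PseudoSph.dy (PseudoSph.dx N) q = Real.cos (θ q) • N q ∧
          PseudoSph.dx (PseudoSph.dy N) q = Real.cos (θ q) • N q) ∧
        -- up to interchanging the coordinates they are positively labelled, and then
        (IsPreconnected T.source →
          PseudoSph.IsPositivelyLabelledOn f T.source ∨
          PseudoSph.IsPositivelyLabelledOn (f ∘ Prod.swap) (Prod.swap ⁻¹' T.source)) ∧
        (PseudoSph.IsPositivelyLabelledOn f T.source →
          ∀ q ∈ T.source,
            PseudoSph.dy (PseudoSph.dx f) q = Real.sin (θ q) • N q ∧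
            PseudoSph.dx f q = PseudoSph.cross (N q) (PseudoSph.dx N q) ∧
            PseudoSph.dy f q = -PseudoSph.cross (N q) (PseudoSph.dy N q))) := by
  have hP := PseudoSph.isPair_of_gaussCurvature hD hf₀ hreg hK
  refine ⟨fun p hp => hP.exists_asymptoticChebyshevChange hD hp, ?_⟩
  rintro T hT f N θ rfl rfl rfl
  -- The curvature hypothesis reaches `f₀ ∘ T` only through the pair, whose normal is then replaced
  -- by the unit normal of `f₀ ∘ T`.
  have hA : PseudoSph.IsAsymptoticPair (f₀ ∘ T) T.source :=
    ⟨T.open_source, (hP.comp ⟨hT.contDiffOn, hT.contDiffOn_symm⟩ hT.target_subset).unitNormal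
      T.open_source, hT.asymptotic⟩
  -- `sin θ = ‖f_x × f_y‖` needs `E = G = 1`, so the two normals are compared on `T.source` only.
  -- Since this set is open, their derivatives agree there too.
  have hN : Set.EqOn (PseudoSph.normalAC (f₀ ∘ T)) (PseudoSph.unitNormal (f₀ ∘ T)) T.source :=
    fun q hq => PseudoSph.normalAC_eq_unitNormal (hT.chebyshev q hq).1 (hT.chebyshev q hq).2
  have hNe : ∀ q ∈ T.source,
      PseudoSph.normalAC (f₀ ∘ T) =ᶠ[nhds q] PseudoSph.unitNormal (f₀ ∘ T) := fun q hq =>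
    hN.eventuallyEq_of_mem (T.open_source.mem_nhds hq)
  have hsin := fun q hq => PseudoSph.sin_theta (hT.chebyshev q hq).1 (hT.chebyshev q hq).2
  refine ⟨hA.isC1M, fun q hq => ?_, hA.isC1M_normal.congr T.open_source hN, fun q hq => ?_,
    fun hc => ?_, fun hpos q hq => ?_⟩
  · have hs : 0 < Real.sin (PseudoSph.theta (f₀ ∘ T) q) := by
      rw [hsin q hq]; exact norm_pos_iff.2 (hA.cross_ne_zero hq)
    constructor
    · refine lt_of_le_of_ne (InnerProductGeometry.angle_nonneg _ _) fun h0 => ?_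
      rw [← h0, Real.sin_zero] at hs
      exact lt_irrefl _ hs
    · refine lt_of_le_of_ne (InnerProductGeometry.angle_le_pi _ _) fun h0 => ?_
      rw [show PseudoSph.theta (f₀ ∘ T) q = Real.pi from h0, Real.sin_pi] at hs
      exact lt_irrefl _ hs
  · rw [PseudoSph.cos_theta (hT.chebyshev q hq).1 (hT.chebyshev q hq).2, hN hq,
      PseudoSph.dy_congr (PseudoSph.dx_eventuallyEq (hNe q hq)),
      PseudoSph.dx_congr (PseudoSph.dy_eventuallyEq (hNe q hq))]
    exact ⟨(hA.hasDerivAt_normal hq).1.deriv, (hA.hasDerivAt_normal hq).2.deriv⟩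
  · refine (hA.coeffM_pos_or_neg hc).imp id fun hneg q hq => ?_
    rw [PseudoSph.coeffM_comp_swap hA.isPair hq]
    exact neg_pos.2 (hneg _ hq)
  · rw [hsin q hq, hN hq, PseudoSph.dx_congr (hNe q hq), PseudoSph.dy_congr (hNe q hq)]
    exact hA.lelieuvre_of_pos hq (hpos q hq)
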